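/- **Universal Coefficient Theorem for Cohomology of Arbitrary Complexes.** Let $\mathcal A$ be an abelian category with enough injectives (for example, the category of left modules over an arbitrary ring), and let $\mathbf C : \cdots \to C_{n+1} \xrightarrow{d_{n+1}} C_n \xrightarrow{d_n} C_{n-1} \to \cdots$ be an arbitrary $\mathbb Z$-indexed complex in $\mathcal A$. Put $B_{n-1} = \operatorname{Im} d_n \subseteq C_{n-1}$, write $(X,-)$ for $\operatorname{Hom}_{\mathcal A}(X,-) : \mathcal A \to \mathbf{Ab}$, and let $F = H^n(\mathbf C,-) : \mathcal A \to \mathbf{Ab}$ be the $n$-th cohomology functor, i.e. the cohomology at $(C_n,-)$ of $\cdots \to (C_{n-1},-) \to (C_n,-) \to (C_{n+1},-)\to\cdots$. For an additive functor $F : \mathcal A \to \mathbf{Ab}$ let $R^iF$ be its right-derived functors ($i \ge 0$), $\rho_F : F \to R^0F$ the canonical transformation, and $\overline F = \operatorname{Ker}\rho_F$ its sub-stabilization. For an object $X$ with injective resolution $0 \to X \to I^0 \to I^1 \to \cdots$ let $\Sigma^0 X = X$ and, for $i \ge 1$, $\Sigma^i X = \operatorname{Ker}(I^i \to I^{i+1})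 = \operatorname{Coker}(\Sigma^{i-1}X \to I^{i-1})$, with canonical maps $e_{i-1} : I^{i-1} \twoheadrightarrow \Sigma^i X$ and $m_i : \Sigma^i X \rightarrowtail I^i$. Then $\overline F\circ\Sigma^i$ is a functor, and so is the right satellite $S^iF$, $S^iF(X) = \operatorname{Coker} F(e_{i-1})$ ($i \ge 1$). The *right fundamental sequence* of $F$ is the sequence of functors $$0 \to \overline F \to F \xrightarrow{\rho_F} R^0F \to \overline F\circ\Sigma \to S^1F \to R^1F \to \overline F\circ\Sigma^2 \to S^2F \to R^2F \to \cdots,$$ in which $\overline F \to F$ is the inclusion and, at $X$, the other maps are as follows: $R^iF(X) \to \overline F(\Sigma^{i+1}X)$ is induced by $F(e_i) : F(I^i) \to F(\Sigma^{i+1}X)$; $\overline F(\Sigma^iX) \to S^iF(X)$ is the composition of $\overline F(\Sigma^iX) \subseteq F(\Sigma^iX)$ with the projection onto $\operatorname{Coker} F(e_{i-1})$; and $S^iF(X) \to R^iF(X)$ is induced by $F(m_i) : F(\Sigma^iX) \to F(I^i)$. The functor $F$ is *half-exact* if it sends every short exact sequence $0 \to X \to Y \to Z \to 0$ to a sequence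 $F(X) \to F(Y) \to F(Z)$ exact at $F(Y)$. Then the following hold for $F = H^n(\mathbf C,-)$. 1. There are isomorphisms of functors $R^0F \cong (H_n(\mathbf C),-)$ and $R^iF \cong \operatorname{Ext}^i(H_n(\mathbf C),-)$ for $i \ge 1$, the first of which can be chosen so that its composition with $\rho_F$ is the canonical evaluation map $H^n(\mathbf C,-) \to (H_n(\mathbf C),-)$. Transported along them, the right fundamental sequence of $F$ has the form $$0 \to \overline{H^n(\mathbf C,-)} \to H^n(\mathbf C,-) \to (H_n(\mathbf C),-) \to \overline{H^n(\mathbf C,-)}\circ\Sigma \to S^1(H^n(\mathbf C,-)) \to \operatorname{Ext}^1(H_n(\mathbf C),-) \to \overline{H^n(\mathbf C,-)}\circ\Sigma^2 \to S^2(H^n(\mathbf C,-)) \to \operatorname{Ext}^2(H_n(\mathbf C),-) \to \cdots.$$ It is a complex, and it is exact except, possibly, at the terms $(H_n(\mathbf C),-)$ and $\operatorname{Ext}^i(H_n(\mathbf C),-)$, $i\ge 1$. 2. If $H^n(\mathbf C,-)$ is half-exact, then this sequence is exact. (This is the case, for example, when all $C_i$ are projective.) 3. The short exact sequence $0 \to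 B_{n-1} \to C_{n-1} \to C_{n-1}/B_{n-1} \to 0$ yields a projective resolution, in the category of additive functors $\mathcal A\to\mathbf{Ab}$, $$0 \to (C_{n-1}/B_{n-1},-) \to (C_{n-1},-) \to (B_{n-1},-) \to \overline{H^n(\mathbf C,-)} \to 0,$$ in which the last map sends $\psi : B_{n-1} \to M$ to the class of the cocycle $C_n \twoheadrightarrow B_{n-1} \xrightarrow{\psi} M$. -/

import Mathlib

open CategoryTheory CategoryTheory.Limits Opposite

universe v u

set_option linter.unusedSectionVars false

noncomputable section

namespace FundSeq

/-! ### Half-exact functors and three-periodic sequences -/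

section General

variable {A : Type*} [Category* A] [Abelian A] {D : Type*} [Category* D] [Abelian D]

/-- `F` is half-exact: it sends every short exact sequence `0 ⟶ X ⟶ Y ⟶ Z ⟶ 0` to a sequence
`F X ⟶ F Y ⟶ F Z` which is exact at `F Y`. -/
def IsHalfExact (F : A ⥤ D) [F.Additive] : Prop :=
  ∀ S : ShortComplex A, S.ShortExact → (S.map F).Exact

/-- `X ⟶ Y ⟶ Z` is a complex and is exact at `Y`. -/
def IsExactAt {X Y Z : D} (f : X ⟶ Y) (g : Y ⟶ Z) : Prop :=
  ∃ w : f ≫ g = 0, (ShortComplex.mk f g w).Exact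

/-- A sequence
`0 ⟶ P 0 ⟶ Q 0 ⟶ R 0 ⟶ P 1 ⟶ Q 1 ⟶ R 1 ⟶ P 2 ⟶ ...` of objects and morphisms. -/
structure RowSequence (D : Type*) [Category* D] where
  P : ℕ → D
  Q : ℕ → D
  R : ℕ → D
  a : ∀ i, P i ⟶ Q i
  b : ∀ i, Q i ⟶ R i
  c : ∀ i, R i ⟶ P (i + 1)

namespace RowSequence

/-- Replace the terms `R i` by isomorphic objects (and transport the maps). -/
def replaceR {D : Type*} [Category* D] (S : RowSequence D) {R' : ℕ → D}
    (e : ∀ i, S.R i ≅ R' i) : RowSequence D where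
  P := S.P
  Q := S.Q
  R := R'
  a := S.a
  b i := S.b i ≫ (e i).hom
  c i := (e i).inv ≫ S.c i

/-- All compositions of two consecutive maps vanish. -/
def IsComplex (S : RowSequence D) : Prop :=
  (∀ i, S.a i ≫ S.b i = 0) ∧ (∀ i, S.b i ≫ S.c i = 0) ∧ (∀ i, S.c i ≫ S.a (i + 1) = 0)

/-- The sequence is exact at all the terms `P i`
(at `P 0` this says that `0 ⟶ P 0 ⟶ Q 0` is exact). -/
def IsExactAtP (S : RowSequence D) : Prop :=
  Mono (S.a 0) ∧ ∀ i, IsExactAt (S.c i) (S.a (i + 1))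

/-- The sequence is exact at all the terms `Q i`. -/
def IsExactAtQ (S : RowSequence D) : Prop :=
  ∀ i, IsExactAt (S.a i) (S.b i)

/-- The sequence is exact at all the terms `R i`. -/
def IsExactAtR (S : RowSequence D) : Prop :=
  ∀ i, IsExactAt (S.b i) (S.c i)

end RowSequence

end General

/-! ### The right fundamental sequence of an additive functor -/

section Fundamental

variable {A : Type u} [Category.{v} A] [Abelian A] [EnoughInjectives A]
  {D : Type*} [Category* D] [Abelian D] (F : A ⥤ D) [F.Additive]

/-- The sub-stabilization of `F`: the kernel of the zeroth right-derived transformation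
`ρ : F ⟶ R⁰F`. -/
def subStab : A ⥤ D := kernel F.toRightDerivedZero

/-- The inclusion of the sub-stabilization. -/
def subStabι : subStab F ⟶ F := kernel.ι F.toRightDerivedZero

lemma subStabι_comp (X : A) :
    (subStabι F).app X ≫ F.toRightDerivedZero.app X = 0 :=
  NatTrans.congr_app (kernel.condition F.toRightDerivedZero) X

/-- The sub-stabilization is computed objectwise as a kernel. -/
def subStabIsKernel (X : A) :
    IsLimit (KernelFork.ofι (f := F.toRightDerivedZero.app X) _ (subStabι_comp F X)) :=
  KernelFork.mapIsLimit _ (kernelIsKernel F.toRightDerivedZero) ((evaluation A D).obj X)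

instance (X : A) : Mono ((subStabι F).app X) :=
  Fork.IsLimit.mono (subStabIsKernel F X)

instance : (subStab F).Additive where
  map_add {X Y f g} := by
    rw [← cancel_mono ((subStabι F).app Y), Preadditive.add_comp]
    simp only [NatTrans.naturality, F.map_add, Preadditive.comp_add]

/-- A morphism to `F X` which vanishes after applying `ρ` lifts to the sub-stabilization. -/
def subStabLift {T : D} {X : A} (g : T ⟶ F.obj X) (h : g ≫ F.toRightDerivedZero.app X = 0) :
    T ⟶ (subStab F).obj X :=
  (subStabIsKernel F X).lift (KernelFork.ofι g h)

@[simp]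
lemma subStabLift_ι {T : D} {X : A} (g : T ⟶ F.obj X)
    (h : g ≫ F.toRightDerivedZero.app X = 0) :
    subStabLift F g h ≫ (subStabι F).app X = g :=
  (subStabIsKernel F X).fac (KernelFork.ofι g h) WalkingParallelPair.zero

lemma isZero_subStab_obj (X : A) [Injective X] : IsZero ((subStab F).obj X) := by
  rw [IsZero.iff_id_eq_zero, ← cancel_mono ((subStabι F).app X),
    ← cancel_mono (F.toRightDerivedZero.app X)]
  simp [subStabι_comp]

lemma comp_toRightDerivedZero_eq_zero {T : D} {X J : A} [Injective J] (m : X ⟶ J) [Mono m]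
    (g : T ⟶ F.obj X) (h : g ≫ F.map m = 0) : g ≫ F.toRightDerivedZero.app X = 0 := by
  have key : g ≫ (injectiveResolution X).toRightDerivedZero' F = 0 := by
    rw [← cancel_mono (HomologicalComplex.iCycles _ _), Category.assoc,
      InjectiveResolution.toRightDerivedZero'_comp_iCycles, zero_comp]
    obtain ⟨t, ht⟩ : ∃ t, (injectiveResolution X).ι.f 0 = m ≫ t := by
      have : Injective ((injectiveResolution X).cocomplex.X 0) :=
        (injectiveResolution X).injective 0
      exact ⟨Injective.factorThru (X := X) ((injectiveResolution X).ι.f 0) m,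
        (Injective.comp_factorThru (X := X) ((injectiveResolution X).ι.f 0) m).symm⟩
    rw [ht]
    erw [F.map_comp, reassoc_of% h, zero_comp]
  rw [(injectiveResolution X).toRightDerivedZero_eq F, reassoc_of% key, zero_comp]

/-- The chosen injective resolution `I⁰ ⟶ I¹ ⟶ I² ⟶ ...` of `X`. -/
abbrev injRes (X : A) : CochainComplex A ℕ := (injectiveResolution X).cocomplex

/-- The lift of a morphism to the chosen injective resolutions. -/
abbrev injResMap {X Y : A} (f : X ⟶ Y) : injRes X ⟶ injRes Y :=
  InjectiveResolution.desc f (injectiveResolution Y) (injectiveResolution X)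

/-- The iterated cosyzygy object `Σⁱ X` for `i ≥ 1`, as the kernel of `Iⁱ ⟶ Iⁱ⁺¹`, i.e. the
cokernel of the inclusion `Σⁱ⁻¹ X ⟶ Iⁱ⁻¹`. The canonical epimorphism `Iⁱ⁻¹ ⟶ Σⁱ X` is
`(injRes X).toCycles (i - 1) i` and the canonical monomorphism `Σⁱ X ⟶ Iⁱ` is
`(injRes X).iCycles i`. -/
abbrev cosyzygy (X : A) (i : ℕ) : A := (injRes X).cycles i

/-- The morphism of cosyzygy objects induced by the chosen lift of `f`. -/
abbrev cosyzygyMap {X Y : A} (f : X ⟶ Y) (i : ℕ) : cosyzygy X i ⟶ cosyzygy Y i :=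
  HomologicalComplex.cyclesMap (injResMap f) i

lemma cyclesMap_sub_eq {K L : CochainComplex A ℕ} {φ ψ : K ⟶ L} (h : Homotopy φ ψ) (i : ℕ) :
    HomologicalComplex.cyclesMap φ (i + 1) = HomologicalComplex.cyclesMap ψ (i + 1) +
      (K.iCycles (i + 1) ≫ h.hom (i + 1) i) ≫ L.toCycles i (i + 1) := by
  rw [← cancel_mono (L.iCycles (i + 1))]
  have h1 := h.comm (i + 1)
  rw [dNext_eq h.hom (show (ComplexShape.up ℕ).Rel (i + 1) (i + 2) by simp),
    prevD_eq h.hom (show (ComplexShape.up ℕ).Rel i (i + 1) by simp)] at h1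
  simp [h1, add_comm]

lemma exists_cosyzygyMap_id (X : A) (i : ℕ) :
    ∃ t : cosyzygy X (i + 1) ⟶ (injRes X).X i,
      cosyzygyMap (𝟙 X) (i + 1) = 𝟙 _ + t ≫ (injRes X).toCycles i (i + 1) := by
  have := cyclesMap_sub_eq (InjectiveResolution.descIdHomotopy X (injectiveResolution X)) i
  rw [HomologicalComplex.cyclesMap_id] at this
  exact ⟨_, this⟩

lemma exists_cosyzygyMap_comp {X Y Z : A} (f : X ⟶ Y) (g : Y ⟶ Z) (i : ℕ) :
    ∃ t : cosyzygy X (i + 1) ⟶ (injRes Z).X i,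
      cosyzygyMap (f ≫ g) (i + 1) = cosyzygyMap f (i + 1) ≫ cosyzygyMap g (i + 1) +
        t ≫ (injRes Z).toCycles i (i + 1) := by
  have := cyclesMap_sub_eq (InjectiveResolution.descCompHomotopy f g
    (injectiveResolution X) (injectiveResolution Y) (injectiveResolution Z)) i
  rw [HomologicalComplex.cyclesMap_comp] at this
  exact ⟨_, this⟩

lemma subStab_map_comp_toCycles {T X : A} (i : ℕ) (t : T ⟶ (injRes X).X i) :
    (subStab F).map (t ≫ (injRes X).toCycles i (i + 1)) = 0 := by
  have : Injective ((injRes X).X i) := (injectiveResolution X).injective i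
  rw [Functor.map_comp, (isZero_subStab_obj F ((injRes X).X i)).eq_of_tgt ((subStab F).map t) 0,
    zero_comp]

/-- The functor `subStab F ∘ Σⁱ⁺¹`. -/
def subStabCosyzygy (i : ℕ) : A ⥤ D where
  obj X := (subStab F).obj (cosyzygy X (i + 1))
  map f := (subStab F).map (cosyzygyMap f (i + 1))
  map_id X := by
    obtain ⟨t, ht⟩ := exists_cosyzygyMap_id X i
    rw [ht, Functor.map_add, subStab_map_comp_toCycles, add_zero, CategoryTheory.Functor.map_id]
  map_comp f g := by
    obtain ⟨t, ht⟩ := exists_cosyzygyMap_comp f g i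
    rw [ht, Functor.map_add, subStab_map_comp_toCycles, add_zero, Functor.map_comp]

/-- The map `F(Iⁱ) ⟶ F(Σⁱ⁺¹ X)` whose cokernel is the satellite `Sⁱ⁺¹F(X) = S¹F(Σⁱ X)`. -/
abbrev satelliteRel (X : A) (i : ℕ) : F.obj ((injRes X).X i) ⟶ F.obj (cosyzygy X (i + 1)) :=
  F.map ((injRes X).toCycles i (i + 1))

lemma satelliteRel_naturality {X Y : A} (f : X ⟶ Y) (i : ℕ) :
    satelliteRel F X i ≫ F.map (cosyzygyMap f (i + 1)) =
      F.map ((injResMap f).f i) ≫ satelliteRel F Y i := by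
  simp only [satelliteRel, ← F.map_comp]
  congr 1
  rw [← cancel_mono ((injRes Y).iCycles (i + 1))]
  simp

/-- The right satellite `Sⁱ⁺¹F = S¹F ∘ Σⁱ`, whose value at `X` is the cokernel of
`F(Iⁱ) ⟶ F(Σⁱ⁺¹ X)`. -/
def satelliteSucc (i : ℕ) : A ⥤ D where
  obj X := cokernel (satelliteRel F X i)
  map f := cokernel.map _ _ _ _ (satelliteRel_naturality F f i)
  map_id X := by
    obtain ⟨t, ht⟩ := exists_cosyzygyMap_id X i
    ext
    simp [ht, F.map_add]
  map_comp {X Y Z} f g := by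
    obtain ⟨t, ht⟩ := exists_cosyzygyMap_comp f g i
    ext
    simp [ht, F.map_add]

/-- The terms `subStab F`, `subStab F ∘ Σ`, `subStab F ∘ Σ²`, ... -/
def fundP : ℕ → (A ⥤ D)
  | 0 => subStab F
  | i + 1 => subStabCosyzygy F i

/-- The terms `F`, `S¹F`, `S²F`, ... -/
def fundQ : ℕ → (A ⥤ D)
  | 0 => F
  | i + 1 => satelliteSucc F i

lemma stabToSatellite_naturality {X Y : A} (f : X ⟶ Y) (i : ℕ) :
    (subStab F).map (cosyzygyMap f (i + 1)) ≫
        (subStabι F).app (cosyzygy Y (i + 1)) ≫ cokernel.π (satelliteRel F Y i) =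
      ((subStabι F).app (cosyzygy X (i + 1)) ≫ cokernel.π (satelliteRel F X i)) ≫
        cokernel.map _ _ _ _ (satelliteRel_naturality F f i) := by
  rw [Category.assoc, cokernel.π_desc, NatTrans.naturality_assoc]

/-- The natural transformation `subStab F ∘ Σⁱ⁺¹ ⟶ Sⁱ⁺¹F`, given by the compositions
`subStab F (Σⁱ⁺¹ X) ⟶ F (Σⁱ⁺¹ X) ⟶ Sⁱ⁺¹F (X)`. -/
def stabToSatellite (i : ℕ) : subStabCosyzygy F i ⟶ satelliteSucc F i where
  app X := (subStabι F).app (cosyzygy X (i + 1)) ≫ cokernel.π (satelliteRel F X i)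
  naturality _ _ f := stabToSatellite_naturality F f i

/-- The maps `subStab F ⟶ F` and `subStab F ∘ Σⁱ ⟶ SⁱF`. -/
def fundA : ∀ i, fundP F i ⟶ fundQ F i
  | 0 => subStabι F
  | i + 1 => stabToSatellite F i

/-- The complex `F(I⁰) ⟶ F(I¹) ⟶ ...` computing the right-derived functors of `F`. -/
abbrev mapInjRes (X : A) : CochainComplex D ℕ := (F.mapHomologicalComplex _).obj (injRes X)

/-- The induced morphism between the complexes computing the right-derived functors. -/
abbrev mapInjResMap {X Y : A} (f : X ⟶ Y) : mapInjRes F X ⟶ mapInjRes F Y :=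
  (F.mapHomologicalComplex _).map (injResMap f)

/-- The inclusion `Ker (F(Iⁱ) ⟶ F(Iⁱ⁺¹)) ⟶ F(Iⁱ)`. -/
def cyclesι (X : A) (i : ℕ) : (mapInjRes F X).cycles i ⟶ F.obj ((injRes X).X i) :=
  (mapInjRes F X).iCycles i

instance (X : A) (i : ℕ) : Mono (cyclesι F X i) :=
  inferInstanceAs (Mono ((mapInjRes F X).iCycles i))

lemma cyclesι_d (X : A) (i j : ℕ) : cyclesι F X i ≫ F.map ((injRes X).d i j) = 0 :=
  (mapInjRes F X).iCycles_d i j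

lemma cyclesι_naturality {X Y : A} (f : X ⟶ Y) (i : ℕ) :
    HomologicalComplex.cyclesMap (mapInjResMap F f) i ≫ cyclesι F Y i =
      cyclesι F X i ≫ F.map ((injResMap f).f i) :=
  HomologicalComplex.cyclesMap_i (mapInjResMap F f) i

/-- The map `F(Iⁱ) ⟶ Ker (F(Iʲ) ⟶ F(Iʲ⁺¹))` induced by the differential. -/
def dToCycles (X : A) (i j : ℕ) : F.obj ((injRes X).X i) ⟶ (mapInjRes F X).cycles j :=
  (mapInjRes F X).toCycles i j

lemma dToCycles_ι (X : A) (i j : ℕ) :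
    dToCycles F X i j ≫ cyclesι F X j = F.map ((injRes X).d i j) :=
  (mapInjRes F X).toCycles_i i j

lemma dToCycles_comp_homologyπ (X : A) (i j : ℕ) :
    dToCycles F X i j ≫ (mapInjRes F X).homologyπ j = 0 :=
  (mapInjRes F X).toCycles_comp_homologyπ i j

/-- The map `F(Σⁱ X) ⟶ Ker (F(Iⁱ) ⟶ F(Iⁱ⁺¹))`. -/
def toCyclesMap (X : A) (i : ℕ) : F.obj (cosyzygy X i) ⟶ (mapInjRes F X).cycles i :=
  (mapInjRes F X).liftCycles (F.map ((injRes X).iCycles i)) (i + 1) (by simp)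
    (((F.map_comp _ _).symm.trans
      (congrArg F.map ((injRes X).iCycles_d i (i + 1)))).trans (F.map_zero _ _))

lemma toCyclesMap_ι (X : A) (i : ℕ) :
    toCyclesMap F X i ≫ cyclesι F X i = F.map ((injRes X).iCycles i) :=
  HomologicalComplex.liftCycles_i _ _ _ _ _

lemma satelliteRel_comp_toCyclesMap (X : A) (i : ℕ) :
    satelliteRel F X i ≫ toCyclesMap F X (i + 1) = dToCycles F X i (i + 1) := by
  rw [← cancel_mono (cyclesι F X (i + 1)), Category.assoc, toCyclesMap_ι, dToCycles_ι,
    ← F.map_comp, HomologicalComplex.toCycles_i]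

lemma toCyclesMap_naturality {X Y : A} (f : X ⟶ Y) (i : ℕ) :
    F.map (cosyzygyMap f i) ≫ toCyclesMap F Y i =
      toCyclesMap F X i ≫ HomologicalComplex.cyclesMap (mapInjResMap F f) i := by
  rw [← cancel_mono (cyclesι F Y i), Category.assoc, Category.assoc, toCyclesMap_ι,
    cyclesι_naturality, reassoc_of% toCyclesMap_ι F X, ← F.map_comp, ← F.map_comp,
    HomologicalComplex.cyclesMap_i]

/-- The map `Sⁱ⁺¹F(X) ⟶ Hⁱ⁺¹(F(I))` induced by `F(Σⁱ⁺¹ X) ⟶ Ker (F(Iⁱ⁺¹) ⟶ F(Iⁱ⁺²))`. -/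
def satelliteToHomology (X : A) (i : ℕ) :
    cokernel (satelliteRel F X i) ⟶ (mapInjRes F X).homology (i + 1) :=
  cokernel.desc _ (toCyclesMap F X (i + 1) ≫ (mapInjRes F X).homologyπ (i + 1)) (by
    rw [reassoc_of% satelliteRel_comp_toCyclesMap F X i, dToCycles_comp_homologyπ])

lemma satelliteToHomology_naturality {X Y : A} (f : X ⟶ Y) (i : ℕ) :
    cokernel.map _ _ _ _ (satelliteRel_naturality F f i) ≫ satelliteToHomology F Y i =
      satelliteToHomology F X i ≫ HomologicalComplex.homologyMap (mapInjResMap F f) (i + 1) := by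
  rw [← cancel_epi (cokernel.π (satelliteRel F X i))]
  simp only [satelliteToHomology, cokernel.π_desc_assoc, Category.assoc, cokernel.π_desc,
    HomologicalComplex.homologyπ_naturality]
  rw [reassoc_of% toCyclesMap_naturality F f]

/-- The value of `RⁱF` at `X` is the cohomology of the complex `F(I)`. -/
def derivedIso (X : A) (i : ℕ) : (F.rightDerived i).obj X ≅ (mapInjRes F X).homology i :=
  (injectiveResolution X).isoRightDerivedObj F i

lemma derivedIso_hom_naturality {X Y : A} (f : X ⟶ Y) (i : ℕ) :
    (F.rightDerived i).map f ≫ (derivedIso F Y i).hom =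
      (derivedIso F X i).hom ≫ HomologicalComplex.homologyMap (mapInjResMap F f) i :=
  InjectiveResolution.isoRightDerivedObj_hom_naturality f _ _ _
    (InjectiveResolution.desc_commutes_zero f _ _) F i

lemma satelliteToDerived_naturality {X Y : A} (f : X ⟶ Y) (i : ℕ) :
    cokernel.map _ _ _ _ (satelliteRel_naturality F f i) ≫
        satelliteToHomology F Y i ≫ (derivedIso F Y (i + 1)).inv =
      (satelliteToHomology F X i ≫ (derivedIso F X (i + 1)).inv) ≫
        (F.rightDerived (i + 1)).map f := by
  rw [← cancel_mono (derivedIso F Y (i + 1)).hom]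
  simp only [Category.assoc, Iso.inv_hom_id, Category.comp_id, derivedIso_hom_naturality,
    Iso.inv_hom_id_assoc, satelliteToHomology_naturality]

/-- The natural transformation `Sⁱ⁺¹F ⟶ Rⁱ⁺¹F`. -/
def satelliteToDerived (i : ℕ) : satelliteSucc F i ⟶ F.rightDerived (i + 1) where
  app X := satelliteToHomology F X i ≫ (derivedIso F X (i + 1)).inv
  naturality _ _ f := satelliteToDerived_naturality F f i

/-- The maps `ρ : F ⟶ R⁰F` and `SⁱF ⟶ RⁱF`. -/
def fundB : ∀ i, fundQ F i ⟶ F.rightDerived i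
  | 0 => F.toRightDerivedZero
  | i + 1 => satelliteToDerived F i

/-- The map `Ker (F(Iⁱ) ⟶ F(Iⁱ⁺¹)) ⟶ subStab F (Σⁱ⁺¹ X)` induced by `F(Iⁱ) ⟶ F(Σⁱ⁺¹ X)`. -/
def cyclesToSubStab (X : A) (i : ℕ) :
    (mapInjRes F X).cycles i ⟶ (subStab F).obj (cosyzygy X (i + 1)) :=
  subStabLift F (cyclesι F X i ≫ satelliteRel F X i) (by
    have : Injective ((injRes X).X (i + 1)) := (injectiveResolution X).injective (i + 1)
    refine comp_toRightDerivedZero_eq_zero F ((injRes X).iCycles (i + 1)) _ ?_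
    rw [Category.assoc, ← F.map_comp, HomologicalComplex.toCycles_i, cyclesι_d])

lemma cyclesToSubStab_ι (X : A) (i : ℕ) :
    cyclesToSubStab F X i ≫ (subStabι F).app (cosyzygy X (i + 1)) =
      cyclesι F X i ≫ satelliteRel F X i :=
  subStabLift_ι F _ _

lemma cyclesToSubStab_naturality {X Y : A} (f : X ⟶ Y) (i : ℕ) :
    HomologicalComplex.cyclesMap (mapInjResMap F f) i ≫ cyclesToSubStab F Y i =
      cyclesToSubStab F X i ≫ (subStab F).map (cosyzygyMap f (i + 1)) := by
  rw [← cancel_mono ((subStabι F).app (cosyzygy Y (i + 1))), Category.assoc, Category.assoc,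
    cyclesToSubStab_ι, NatTrans.naturality, reassoc_of% cyclesToSubStab_ι F X, reassoc_of% cyclesι_naturality F f,
    satelliteRel_naturality]

lemma toCycles_comp_cyclesToSubStab (X : A) (j i : ℕ) :
    (mapInjRes F X).toCycles j i ≫ cyclesToSubStab F X i = 0 := by
  have h : dToCycles F X j i ≫ cyclesToSubStab F X i = 0 := by
    rw [← cancel_mono ((subStabι F).app (cosyzygy X (i + 1))), Category.assoc,
      cyclesToSubStab_ι, ← Category.assoc, dToCycles_ι, ← F.map_comp,
      HomologicalComplex.d_toCycles, F.map_zero, zero_comp]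
  exact h

/-- The map `Hⁱ(F(I)) ⟶ subStab F (Σⁱ⁺¹ X)` induced by `F(Iⁱ) ⟶ F(Σⁱ⁺¹ X)`. -/
def homologyToSubStab (X : A) (i : ℕ) :
    (mapInjRes F X).homology i ⟶ (subStab F).obj (cosyzygy X (i + 1)) :=
  ((mapInjRes F X).homologyIsCokernel _ i rfl).desc
    (CokernelCofork.ofπ (cyclesToSubStab F X i) (toCycles_comp_cyclesToSubStab F X _ i))

lemma homologyπ_homologyToSubStab (X : A) (i : ℕ) :
    (mapInjRes F X).homologyπ i ≫ homologyToSubStab F X i = cyclesToSubStab F X i :=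
  ((mapInjRes F X).homologyIsCokernel _ i rfl).fac _ WalkingParallelPair.one

lemma homologyToSubStab_naturality {X Y : A} (f : X ⟶ Y) (i : ℕ) :
    HomologicalComplex.homologyMap (mapInjResMap F f) i ≫ homologyToSubStab F Y i =
      homologyToSubStab F X i ≫ (subStab F).map (cosyzygyMap f (i + 1)) := by
  rw [← cancel_epi ((mapInjRes F X).homologyπ i), HomologicalComplex.homologyπ_naturality_assoc,
    homologyπ_homologyToSubStab, reassoc_of% homologyπ_homologyToSubStab F X i, cyclesToSubStab_naturality]

lemma derivedToStab_naturality {X Y : A} (f : X ⟶ Y) (i : ℕ) :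
    (F.rightDerived i).map f ≫ (derivedIso F Y i).hom ≫ homologyToSubStab F Y i =
      ((derivedIso F X i).hom ≫ homologyToSubStab F X i) ≫
        (subStab F).map (cosyzygyMap f (i + 1)) := by
  rw [← Category.assoc, derivedIso_hom_naturality, Category.assoc, Category.assoc,
    homologyToSubStab_naturality]

/-- The natural transformation `RⁱF ⟶ subStab F ∘ Σⁱ⁺¹` (which is `β` for `i = 0`). -/
def derivedToStab (i : ℕ) : F.rightDerived i ⟶ subStabCosyzygy F i where
  app X := (derivedIso F X i).hom ≫ homologyToSubStab F X i
  naturality _ _ f := derivedToStab_naturality F f i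

/-- The maps `β : R⁰F ⟶ subStab F ∘ Σ` and `RⁱF ⟶ subStab F ∘ Σⁱ⁺¹`. -/
def fundC (i : ℕ) : F.rightDerived i ⟶ fundP F (i + 1) := derivedToStab F i

/-- The right fundamental sequence
`0 ⟶ subStab F ⟶ F ⟶ R⁰F ⟶ subStab F ∘ Σ ⟶ S¹F ⟶ R¹F ⟶ subStab F ∘ Σ² ⟶ S²F ⟶ R²F ⟶ ...`. -/
def fundamentalSequence : RowSequence (A ⥤ D) where
  P := fundP F
  Q := fundQ F
  R := F.rightDerived
  a := fundA F
  b := fundB F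
  c := fundC F

end Fundamental

/-! ### Cohomology of a complex with coefficients -/

section Cohomology

variable {A : Type u} [Category.{v} A] [Abelian A]

/-- The covariant representable functor `(X, -)` with values in abelian groups. -/
abbrev rep (X : A) : A ⥤ AddCommGrpCat.{v} := preadditiveCoyoneda.obj (op X)

/-- The natural transformation `(Y, -) ⟶ (X, -)` induced by `f : X ⟶ Y`. -/
abbrev repMap {X Y : A} (f : X ⟶ Y) : rep Y ⟶ rep X := preadditiveCoyoneda.map f.op

instance : (preadditiveCoyoneda : Aᵒᵖ ⥤ A ⥤ AddCommGrpCat.{v}).Additive where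
  map_add {X Y f g} := by
    ext Z z
    exact Preadditive.add_comp _ _ _ f.unop g.unop z

/-- The complex of functors `... ⟶ (C_{n-1}, -) ⟶ (C_n, -) ⟶ (C_{n+1}, -) ⟶ ...`,
with `(C_n, -)` in cohomological degree `n`. -/
def homComplex (C : ChainComplex A ℤ) :
    HomologicalComplex (A ⥤ AddCommGrpCat.{v}) (ComplexShape.down ℤ).symm :=
  (preadditiveCoyoneda.mapHomologicalComplex _).obj C.op

lemma additive_of_mono_of_epi {D : Type*} [Category* D] [Abelian D] {G Z H : A ⥤ D}
    (j : Z ⟶ G) (p : Z ⟶ H) [Mono j] [hp : Epi p] (hG : G.Additive) : H.Additive where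
  map_add {X Y f g} := by
    have hZ : Z.map (f + g) = Z.map f + Z.map g := by
      rw [← cancel_mono (j.app Y), Preadditive.add_comp]
      simp only [NatTrans.naturality, G.map_add, Preadditive.comp_add]
    rw [← cancel_epi (p.app X), Preadditive.comp_add]
    simp only [← NatTrans.naturality, hZ, Preadditive.add_comp]

/-- The cohomology functor `Hⁿ(C, -)`: the cohomology in degree `n` of the complex `(C, -)`. -/
def cohomologyFunctor (C : ChainComplex A ℤ) (n : ℤ) : A ⥤ AddCommGrpCat.{v} :=
  (homComplex C).homology n

instance (C : ChainComplex A ℤ) (n : ℤ) : (cohomologyFunctor C n).Additive :=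
  additive_of_mono_of_epi (G := (homComplex C).X n) ((homComplex C).iCycles n)
    (hp := inferInstanceAs (Epi ((homComplex C).homologyπ n))) ((homComplex C).homologyπ n)
    (inferInstanceAs (preadditiveCoyoneda.obj (op (C.X n))).Additive)

/-- `Ext^i(X, -)`, with values in the universe of the morphisms of `A` (as `A` has enough
injectives). -/
def extFunctor [EnoughInjectives A] (X : A) (i : ℕ) : A ⥤ AddCommGrpCat.{v} :=
  letI : HasExt.{v} A := hasExt_of_enoughInjectives.{v} A
  Abelian.extFunctorObj.{v} X i

/-- `(X, -)` for `i = 0`, and `Ext^i(X, -)` for `i ≥ 1`. -/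
def homExtFunctor [EnoughInjectives A] (X : A) : ℕ → (A ⥤ AddCommGrpCat.{v})
  | 0 => rep X
  | i + 1 => extFunctor X (i + 1)

/-- The boundaries `B_{n-1}`, i.e. the image of `d_n : C_n ⟶ C_{n-1}`. -/
abbrev prevBoundaries (C : ChainComplex A ℤ) (n : ℤ) : A := image (C.d n (n - 1))

/-- The inclusion `B_{n-1} ⟶ C_{n-1}`. -/
abbrev prevBoundariesι (C : ChainComplex A ℤ) (n : ℤ) : prevBoundaries C n ⟶ C.X (n - 1) :=
  image.ι (C.d n (n - 1))

/-- The epimorphism `C_n ⟶ B_{n-1}` induced by `d_n`. -/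
abbrev toPrevBoundaries (C : ChainComplex A ℤ) (n : ℤ) : C.X n ⟶ prevBoundaries C n :=
  factorThruImage (C.d n (n - 1))

/-- The projection `C_{n-1} ⟶ C_{n-1}/B_{n-1}`. -/
abbrev prevBoundariesπ (C : ChainComplex A ℤ) (n : ℤ) :
    C.X (n - 1) ⟶ cokernel (prevBoundariesι C n) :=
  cokernel.π (prevBoundariesι C n)

/-- `π : Zⁿ(C, -) ⟶ Hⁿ(C, -)` is the projection of cocycles onto cohomology. -/
def cocyclesπ (C : ChainComplex A ℤ) (n : ℤ) :
    (homComplex C).cycles n ⟶ cohomologyFunctor C n :=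
  (homComplex C).homologyπ n

/-- The inclusion of the functor of cocycles into `(C_n, -)`. -/
def cocyclesι (C : ChainComplex A ℤ) (n : ℤ) : (homComplex C).cycles n ⟶ rep (C.X n) :=
  (homComplex C).iCycles n

/-- `κ : Hⁿ(C, -) ⟶ (H_n(C), -)` is the canonical evaluation map: it sends the class of a cocycle
`φ : C_n ⟶ M` to the morphism `H_n(C) ⟶ M` induced by the restriction of `φ` to the cycles
`Z_n`. -/
def IsEvaluation (C : ChainComplex A ℤ) (n : ℤ)
    (κ : cohomologyFunctor C n ⟶ rep (C.homology n)) : Prop :=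
  cocyclesπ C n ≫ κ ≫ repMap (C.homologyπ n) = cocyclesι C n ≫ repMap (C.iCycles n)

/-- The inclusion of `Hⁿ(C, -)` into the cokernel of `(C_{n-1}, -) ⟶ (C_n, -)`. -/
def toCokernel (C : ChainComplex A ℤ) (n : ℤ) :
    cohomologyFunctor C n ⟶ (homComplex C).opcycles n :=
  (homComplex C).homologyι n

/-- The projection of `(C_n, -)` onto the cokernel of `(C_{n-1}, -) ⟶ (C_n, -)`. -/
def cochainsπ (C : ChainComplex A ℤ) (n : ℤ) : rep (C.X n) ⟶ (homComplex C).opcycles n :=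
  (homComplex C).pOpcycles n

/-- `q : (B_{n-1}, -) ⟶ subStab Hⁿ(C, -)` is the canonical map: it sends `ψ : B_{n-1} ⟶ M` to the
class of the cocycle `C_n ⟶ B_{n-1} ⟶ M`. -/
def IsClassMap [EnoughInjectives A] (C : ChainComplex A ℤ) (n : ℤ)
    (q : rep (prevBoundaries C n) ⟶ subStab (cohomologyFunctor C n)) : Prop :=
  q ≫ subStabι (cohomologyFunctor C n) ≫ toCokernel C n =
    repMap (toPrevBoundaries C n) ≫ cochainsπ C n

/-- The sequence `0 ⟶ P₂ ⟶ P₁ ⟶ P₀ ⟶ G ⟶ 0` is a projective resolution of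
`G` in the category of additive functors. Exactness is objectwise, so it may be tested in the
category of all functors. -/
structure IsProjectiveResolution {P₂ P₁ P₀ G : A ⥤ AddCommGrpCat.{v}}
    [P₂.Additive] [P₁.Additive] [P₀.Additive]
    (f₂ : P₂ ⟶ P₁) (f₁ : P₁ ⟶ P₀) (q : P₀ ⟶ G) : Prop where
  projective₂ : Projective (AdditiveFunctor.of P₂)
  projective₁ : Projective (AdditiveFunctor.of P₁)
  projective₀ : Projective (AdditiveFunctor.of P₀)
  mono : Mono f₂
  exact₁ : IsExactAt f₂ f₁
  exact₀ : IsExactAt f₁ q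
  epi : Epi q

end Cohomology

end FundSeq

end

noncomputable section

namespace FundSeq

/-! ### Exactness in functor categories and replacement of terms -/

section General

variable {A : Type*} [Category* A] {D : Type*} [Category* D] [Abelian D]

/-! Write `F` for `Hⁿ(C, -)`. If `J` is injective then `(-, J)` is exact, so the evaluation map `F J
⟶ (H_n(C), J)` is an isomorphism (`isIso_evaluationMap_app`). Right-derived functors see only the
values on injectives (`isIso_rightDerived`), hence those of `F` are those of `(H_n(C), -)`, namely
`(H_n(C), -)` itself, by left exactness, and `Extⁱ(H_n(C), -)`, computed by cocycles in an injective
resolution. Naturality of `ρ` in the functor turns `ρ_F` into evaluation.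

The exactness statements hold for every additive `F`. For a monomorphism `m : X ⟶ J` into an
injective, the sub-stabilization at `X` is the kernel of `F(m)`. The fundamental sequence then comes
from a chase around `F(Iⁱ) ⟶ F(Σⁱ⁺¹ X) ⟶ F(Iⁱ⁺¹)`, whose composite is the differential. Only
exactness at `RⁱF` asks for more: an element of `F(Iⁱ)` killed in `F(Σⁱ⁺¹ X)` has to come from `F(Σⁱ
X)`, which is half-exactness applied to `0 ⟶ Σⁱ X ⟶ Iⁱ ⟶ Σⁱ⁺¹ X ⟶ 0`.

For the resolution, a class killed by evaluation is given by a cocycle that vanishes on `Z_n`, i.e.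
one that factors through `C_n/Z_n = B_{n-1}`. It is a coboundary exactly when the factor extends to
`C_{n-1}`. Projectivity of representables is the Yoneda lemma. -/

lemma shortComplex_exact_of_evaluation (S : ShortComplex (A ⥤ D))
    (h : ∀ X, (S.map ((evaluation A D).obj X)).Exact) : S.Exact := by
  rw [ShortComplex.exact_iff_isZero_homology, Functor.isZero_iff]
  intro X
  -- Evaluation at `X` is exact, so homology in the functor category is computed objectwise.
  exact ((ShortComplex.exact_iff_isZero_homology _).1 (h X)).of_iso
    (S.mapHomologyIso ((evaluation A D).obj X)).symm

lemma isExactAt_of_app {F G H : A ⥤ D} {f : F ⟶ G} {g : G ⟶ H}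
    (h : ∀ X, IsExactAt (f.app X) (g.app X)) : IsExactAt f g :=
  ⟨by ext X : 2; exact (h X).1, shortComplex_exact_of_evaluation _ fun X => (h X).2⟩

/-- Permits element-style chases in an arbitrary abelian `D`: a preimage exists after passing to an
epimorphic cover of the test object. -/
lemma isExactAt_iff_refinements {X Y Z : D} {f : X ⟶ Y} {g : Y ⟶ Z} :
    IsExactAt f g ↔ f ≫ g = 0 ∧ ∀ ⦃T : D⦄ (y : T ⟶ Y), y ≫ g = 0 →
      ∃ (T' : D) (p : T' ⟶ T) (_ : Epi p) (x : T' ⟶ X), p ≫ y = x ≫ f :=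
  ⟨fun ⟨w, h⟩ => ⟨w, (ShortComplex.exact_iff_exact_up_to_refinements _).1 h⟩,
    fun ⟨w, h⟩ => ⟨w, (ShortComplex.exact_iff_exact_up_to_refinements _).2 h⟩⟩

lemma IsExactAt.of_iso {X Y Z X' Y' Z' : D} {f : X ⟶ Y} {g : Y ⟶ Z} {f' : X' ⟶ Y'}
    {g' : Y' ⟶ Z'} (h : IsExactAt f g) (e₁ : X ≅ X') (e₂ : Y ≅ Y') (e₃ : Z ≅ Z')
    (hf : f ≫ e₂.hom = e₁.hom ≫ f') (hg : g ≫ e₃.hom = e₂.hom ≫ g') : IsExactAt f' g' := by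
  obtain ⟨w, h⟩ := h
  have w' : f' ≫ g' = 0 := by
    rw [← cancel_epi e₁.hom, ← Category.assoc, ← hf, Category.assoc, ← hg, ← Category.assoc, w,
      zero_comp, comp_zero]
  exact ⟨w', ShortComplex.exact_of_iso
    (ShortComplex.isoMk e₁ e₂ e₃ hf.symm hg.symm :
      ShortComplex.mk f g w ≅ ShortComplex.mk f' g' w') h⟩

namespace RowSequence

variable {S : RowSequence D} {R' : ℕ → D} (e : ∀ i, S.R i ≅ R' i)

lemma IsComplex.replaceR (h : S.IsComplex) : (S.replaceR e).IsComplex := by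
  obtain ⟨h₁, h₂, h₃⟩ := h
  refine ⟨fun i => ?_, fun i => ?_, fun i => ?_⟩
  · exact (Category.assoc _ _ _).symm.trans ((congrArg (· ≫ _) (h₁ i)).trans zero_comp)
  · simp only [RowSequence.replaceR, Category.assoc, Iso.hom_inv_id_assoc, h₂ i]
    rfl
  · exact (Category.assoc _ _ _).trans ((congrArg _ (h₃ i)).trans comp_zero)

lemma IsExactAtP.replaceR (h : S.IsExactAtP) : (S.replaceR e).IsExactAtP :=
  ⟨h.1, fun i => (h.2 i).of_iso (e i) (Iso.refl _) (Iso.refl _)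
    (by simp [RowSequence.replaceR]) (by simp [RowSequence.replaceR])⟩

lemma IsExactAtQ.replaceR (h : S.IsExactAtQ) : (S.replaceR e).IsExactAtQ :=
  fun i => (h i).of_iso (Iso.refl _) (Iso.refl _) (e i)
    (by simp [RowSequence.replaceR]) (by simp [RowSequence.replaceR])

lemma IsExactAtR.replaceR (h : S.IsExactAtR) : (S.replaceR e).IsExactAtR :=
  fun i => (h i).of_iso (Iso.refl _) (e i) (Iso.refl _)
    (by simp [RowSequence.replaceR]) (by simp [RowSequence.replaceR])

end RowSequence

end General

/-! ### Exactness of the right fundamental sequence -/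

section Fundamental

variable {A : Type u} [Category.{v} A] [Abelian A] [EnoughInjectives A]

instance (X : A) (i : ℕ) : Injective ((injRes X).X i) := (injectiveResolution X).injective i

/-- The inclusion of `X` in the first term of its injective resolution. -/
def injResι (X : A) : X ⟶ (injRes X).X 0 := (injectiveResolution X).ι.f 0

instance (X : A) : Mono (injResι X) := inferInstanceAs (Mono ((injectiveResolution X).ι.f 0))

lemma injResι_toCycles (X : A) : injResι X ≫ (injRes X).toCycles 0 1 = 0 := by
  rw [← cancel_mono ((injRes X).iCycles 1), Category.assoc, HomologicalComplex.toCycles_i,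
    zero_comp]
  exact (injectiveResolution X).ι_f_zero_comp_complex_d

/-- This is exactness of the resolution in degree `i + 1`: every cycle is locally a boundary. -/
instance (X : A) (i : ℕ) : Epi ((injRes X).toCycles i (i + 1)) := by
  rw [epi_iff_surjective_up_to_refinements]
  intro T y
  obtain ⟨T', p, hp, x, hx⟩ := ((injRes X).exactAt_iff_exact_up_to_refinements i (i + 1) (i + 2)
    (by simp) (by simp only [CochainComplex.next]; rfl)).1
      ((injectiveResolution X).cocomplex_exactAt_succ i)
      (y ≫ (injRes X).iCycles (i + 1)) (by simp)
  refine ⟨T', p, hp, x, ?_⟩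
  rw [← cancel_mono ((injRes X).iCycles (i + 1))]
  simpa using hx

/-- The bottom cosyzygy sequence is stated with `X` itself, since `Σ⁰ X = X`, whereas the
degree-zero cycles are only isomorphic to `X`. -/
lemma injResι_shortExact (X : A) :
    (ShortComplex.mk _ _ (injResι_toCycles X)).ShortExact where
  exact := by
    apply ShortComplex.exact_of_f_is_kernel
    refine KernelFork.IsLimit.ofι' _ _ fun {W} k hk => ?_
    exact KernelFork.IsLimit.lift' (injectiveResolution X).isLimitKernelFork k (by
      change k ≫ (injRes X).d 0 1 = 0
      rw [← HomologicalComplex.toCycles_i]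
      exact (Category.assoc _ _ _).symm.trans ((congrArg (· ≫ _) hk).trans zero_comp))
  mono_f := inferInstanceAs (Mono (injResι X))
  epi_g := inferInstanceAs (Epi ((injRes X).toCycles 0 1))

lemma iCycles_comp_toCycles (X : A) (i : ℕ) :
    (injRes X).iCycles i ≫ (injRes X).toCycles i (i + 1) = 0 := by
  rw [← cancel_mono ((injRes X).iCycles (i + 1))]
  simp

lemma cosyzygy_shortExact (X : A) (i : ℕ) :
    (ShortComplex.mk _ _ (iCycles_comp_toCycles X i)).ShortExact where
  exact := by
    apply ShortComplex.exact_of_f_is_kernel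
    refine KernelFork.IsLimit.ofι' _ _ fun {W} k hk =>
      ⟨(injRes X).liftCycles k (i + 1) (by simp) ?_, HomologicalComplex.liftCycles_i _ _ _ _ _⟩
    rw [← HomologicalComplex.toCycles_i]
    exact (Category.assoc _ _ _).symm.trans ((congrArg (· ≫ _) hk).trans zero_comp)
  mono_f := inferInstanceAs (Mono ((injRes X).iCycles i))
  epi_g := inferInstanceAs (Epi ((injRes X).toCycles i (i + 1)))

/-! ### Objectwise exactness of the fundamental sequence -/

variable {D : Type*} [Category* D] [Abelian D] (F : A ⥤ D) [F.Additive]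

/-- The sub-stabilization vanishes on injectives. With `comp_toRightDerivedZero_eq_zero` this
identifies it with `Ker F(m)` when `m` is a monomorphism. -/
lemma subStabι_comp_map {X J : A} [Injective J] (m : X ⟶ J) :
    (subStabι F).app X ≫ F.map m = 0 := by
  rw [← (subStabι F).naturality, (isZero_subStab_obj F J).eq_of_tgt ((subStab F).map m) 0,
    zero_comp]

lemma toRightDerivedZero_comp_derivedIso (X : A) :
    F.toRightDerivedZero.app X ≫ (derivedIso F X 0).hom =
      (injectiveResolution X).toRightDerivedZero' F ≫ (mapInjRes F X).homologyπ 0 := by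
  rw [(injectiveResolution X).toRightDerivedZero_eq F, ← Iso.eq_comp_inv]
  exact (Category.assoc _ _ _).symm

lemma toRightDerivedZero'_comp_cyclesι (X : A) :
    (injectiveResolution X).toRightDerivedZero' F ≫ cyclesι F X 0 = F.map (injResι X) :=
  InjectiveResolution.toRightDerivedZero'_comp_iCycles _ _

lemma exists_comp_cyclesι {T : D} (X : A) (i : ℕ) (y : T ⟶ F.obj ((injRes X).X i))
    (hy : y ≫ F.map ((injRes X).d i (i + 1)) = 0) :
    ∃ z : T ⟶ (mapInjRes F X).cycles i, z ≫ cyclesι F X i = y :=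
  ⟨(mapInjRes F X).liftCycles y (i + 1) (by simp) hy,
    HomologicalComplex.liftCycles_i _ _ _ _ _⟩

lemma homologyToSubStab_exact (X : A) (i : ℕ) :
    IsExactAt (homologyToSubStab F X i)
      ((subStabι F).app (cosyzygy X (i + 1)) ≫ cokernel.π (satelliteRel F X i)) := by
  rw [isExactAt_iff_refinements]
  constructor
  · rw [← cancel_epi ((mapInjRes F X).homologyπ i), comp_zero,
      reassoc_of% homologyπ_homologyToSubStab F X i]
    rw [reassoc_of% cyclesToSubStab_ι F X i, cokernel.condition, comp_zero]
  · intro T x hx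
    obtain ⟨T', p, hp, y, hy⟩ := (ShortComplex.exact_iff_exact_up_to_refinements _).1
      (ShortComplex.exact_cokernel (satelliteRel F X i))
      (x ≫ (subStabι F).app (cosyzygy X (i + 1))) ((Category.assoc _ _ _).trans hx)
    dsimp at y hy
    -- The preimage `y` is automatically a cycle: its differential is the image in `F(Iⁱ⁺¹)` of an
    -- element of the sub-stabilization, hence zero.
    obtain ⟨z, hz⟩ := exists_comp_cyclesι F X i y (by
      rw [← HomologicalComplex.toCycles_i, F.map_comp, ← reassoc_of% hy, subStabι_comp_map,
        comp_zero, comp_zero])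
    refine ⟨T', p, hp, z ≫ (mapInjRes F X).homologyπ i, ?_⟩
    rw [Category.assoc, homologyπ_homologyToSubStab]
    refine (cancel_mono ((subStabι F).app (cosyzygy X (i + 1)))).1 ?_
    rw [Category.assoc, Category.assoc, cyclesToSubStab_ι, reassoc_of% hz]
    exact hy

lemma π_satelliteToHomology (X : A) (i : ℕ) :
    cokernel.π (satelliteRel F X i) ≫ satelliteToHomology F X i =
      toCyclesMap F X (i + 1) ≫ (mapInjRes F X).homologyπ (i + 1) :=
  cokernel.π_desc _ _ _

lemma stabToSatellite_exact (X : A) (i : ℕ) :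
    IsExactAt ((subStabι F).app (cosyzygy X (i + 1)) ≫ cokernel.π (satelliteRel F X i))
      (satelliteToHomology F X i) := by
  rw [isExactAt_iff_refinements]
  constructor
  · rw [Category.assoc, π_satelliteToHomology]
    have : (subStabι F).app (cosyzygy X (i + 1)) ≫ toCyclesMap F X (i + 1) = 0 := by
      rw [← cancel_mono (cyclesι F X (i + 1)), Category.assoc, toCyclesMap_ι, subStabι_comp_map,
        zero_comp]
    rw [reassoc_of% this, zero_comp]
  · intro T x hx
    obtain ⟨T', p, hp, y, hy⟩ :=
      surjective_up_to_refinements_of_epi (cokernel.π (satelliteRel F X i)) x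
    have h : (y ≫ toCyclesMap F X (i + 1)) ≫ (mapInjRes F X).homologyπ (i + 1) = 0 := by
      rw [Category.assoc, ← π_satelliteToHomology, ← Category.assoc, ← hy, Category.assoc, hx,
        comp_zero]
    obtain ⟨T'', p', hp', z, hz⟩ :=
      ((mapInjRes F X).comp_homologyπ_eq_zero_iff_up_to_refinements i (i + 1) (by simp) _).1 h
    change T'' ⟶ F.obj ((injRes X).X i) at z
    replace hz : p' ≫ y ≫ toCyclesMap F X (i + 1) =
      z ≫ satelliteRel F X i ≫ toCyclesMap F X (i + 1) := by
        rw [satelliteRel_comp_toCyclesMap]; exact hz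
    -- The image of `y` in `F(Iⁱ⁺¹)` is the differential of `z`. Subtracting the image of `z` in
    -- `F(Σⁱ⁺¹ X)` leaves the class in the cokernel unchanged and gives an element of `Ker F(m)`,
    -- which is the sub-stabilization.
    refine ⟨T'', p' ≫ p, epi_comp _ _, subStabLift F (p' ≫ y - z ≫ satelliteRel F X i) ?_, ?_⟩
    · refine comp_toRightDerivedZero_eq_zero F ((injRes X).iCycles (i + 1)) _ ?_
      rw [← toCyclesMap_ι, ← Category.assoc, Preadditive.sub_comp, Category.assoc,
        Category.assoc, hz, sub_self, zero_comp]
    · rw [← Category.assoc (subStabLift F _ _), subStabLift_ι, Preadditive.sub_comp,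
        Category.assoc, Category.assoc, Category.assoc, hy, cokernel.condition, comp_zero,
        sub_zero]

lemma satelliteToHomology_comp (X : A) (i : ℕ) :
    satelliteToHomology F X i ≫ homologyToSubStab F X (i + 1) = 0 := by
  rw [← cancel_epi (cokernel.π (satelliteRel F X i)), reassoc_of% π_satelliteToHomology F X i,
    homologyπ_homologyToSubStab, comp_zero,
    ← cancel_mono ((subStabι F).app (cosyzygy X (i + 1 + 1))), Category.assoc, cyclesToSubStab_ι,
    reassoc_of% toCyclesMap_ι F X (i + 1), ← F.map_comp, iCycles_comp_toCycles, F.map_zero,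
    zero_comp]

lemma toRightDerivedZero_comp (X : A) :
    ((injectiveResolution X).toRightDerivedZero' F ≫ (mapInjRes F X).homologyπ 0) ≫
      homologyToSubStab F X 0 = 0 := by
  rw [Category.assoc, homologyπ_homologyToSubStab,
    ← cancel_mono ((subStabι F).app (cosyzygy X (0 + 1))), Category.assoc, cyclesToSubStab_ι,
    reassoc_of% toRightDerivedZero'_comp_cyclesι F X, ← F.map_comp, injResι_toCycles, F.map_zero,
    zero_comp]

/-- Common start of both half-exactness arguments. Boundaries already die in `F(Σⁱ⁺¹ X)`, so any
representing cycle is killed there on the nose. -/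
lemma exists_cycle_of_comp_homologyToSubStab_eq_zero {T : D} (X : A) (i : ℕ)
    (x : T ⟶ (mapInjRes F X).homology i) (hx : x ≫ homologyToSubStab F X i = 0) :
    ∃ (T' : D) (p : T' ⟶ T) (_ : Epi p) (y : T' ⟶ (mapInjRes F X).cycles i),
      p ≫ x = y ≫ (mapInjRes F X).homologyπ i ∧
        (y ≫ cyclesι F X i) ≫ satelliteRel F X i = 0 := by
  obtain ⟨T', p, hp, y, hy⟩ :=
    surjective_up_to_refinements_of_epi ((mapInjRes F X).homologyπ i) x
  refine ⟨T', p, hp, y, hy, ?_⟩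
  rw [Category.assoc, ← cyclesToSubStab_ι, ← homologyπ_homologyToSubStab, Category.assoc,
    ← reassoc_of% hy, reassoc_of% hx, zero_comp, comp_zero]

variable {F}

lemma satelliteToHomology_exact (hF : IsHalfExact F) (X : A) (i : ℕ) :
    IsExactAt (satelliteToHomology F X i) (homologyToSubStab F X (i + 1)) := by
  rw [isExactAt_iff_refinements]
  refine ⟨satelliteToHomology_comp F X i, fun T x hx => ?_⟩
  obtain ⟨T', p, hp, y, hy, h⟩ := exists_cycle_of_comp_homologyToSubStab_eq_zero F X (i + 1) x hx
  -- Half-exactness lifts the representing cycle from `F(Iⁱ⁺¹)` to `F(Σⁱ⁺¹ X)`; the class of the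
  -- lift in the satellite is the preimage.
  obtain ⟨T'', p', hp', z, hz⟩ := (ShortComplex.exact_iff_exact_up_to_refinements _).1
    (hF _ (cosyzygy_shortExact X (i + 1))) _ h
  change T'' ⟶ F.obj _ at z
  change p' ≫ y ≫ cyclesι F X _ = z ≫ F.map _ at hz
  refine ⟨T'', p' ≫ p, epi_comp _ _, z ≫ cokernel.π (satelliteRel F X i), ?_⟩
  rw [Category.assoc, hy, Category.assoc, π_satelliteToHomology,
    ← Category.assoc, ← Category.assoc]
  congr 1
  rw [← cancel_mono (cyclesι F X (i + 1)), Category.assoc, Category.assoc, toCyclesMap_ι, hz]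

lemma toRightDerivedZero_exact (hF : IsHalfExact F) (X : A) :
    IsExactAt ((injectiveResolution X).toRightDerivedZero' F ≫ (mapInjRes F X).homologyπ 0)
      (homologyToSubStab F X 0) := by
  rw [isExactAt_iff_refinements]
  refine ⟨toRightDerivedZero_comp F X, fun T x hx => ?_⟩
  obtain ⟨T', p, hp, y, hy, h⟩ := exists_cycle_of_comp_homologyToSubStab_eq_zero F X 0 x hx
  obtain ⟨T'', p', hp', z, hz⟩ := (ShortComplex.exact_iff_exact_up_to_refinements _).1
    (hF _ (injResι_shortExact X)) _ h
  change T'' ⟶ F.obj _ at z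
  change p' ≫ y ≫ cyclesι F X _ = z ≫ F.map _ at hz
  refine ⟨T'', p' ≫ p, epi_comp _ _, z, ?_⟩
  rw [Category.assoc, hy, ← Category.assoc, ← Category.assoc]
  congr 1
  rw [← cancel_mono (cyclesι F X 0), Category.assoc, Category.assoc,
    toRightDerivedZero'_comp_cyclesι, hz]

/-! ### The fundamental sequence as a sequence of functors -/

variable (F)

lemma fundamentalSequence_isExactAtP : (fundamentalSequence F).IsExactAtP := by
  refine ⟨inferInstanceAs (Mono (kernel.ι F.toRightDerivedZero)), fun i => isExactAt_of_app
    fun X => (homologyToSubStab_exact F X i).of_iso (derivedIso F X i).symm (Iso.refl _)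
      (Iso.refl _) ?_ ?_⟩
  · exact (Category.comp_id _).trans (Iso.inv_hom_id_assoc _ _).symm
  · exact (Category.comp_id _).trans (Category.id_comp _).symm

lemma fundamentalSequence_isExactAtQ : (fundamentalSequence F).IsExactAtQ := by
  rintro (_ | i)
  · exact ⟨kernel.condition _, ShortComplex.exact_of_f_is_kernel _
      (kernelIsKernel F.toRightDerivedZero)⟩
  · exact isExactAt_of_app fun X => (stabToSatellite_exact F X i).of_iso (Iso.refl _) (Iso.refl _)
      (derivedIso F X (i + 1)).symm ((Category.comp_id _).trans (Category.id_comp _).symm)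
      (Category.id_comp _).symm

lemma fundB_zero_comp_derivedIso (X : A) :
    ((fundamentalSequence F).b 0).app X ≫ (derivedIso F X 0).hom =
      (injectiveResolution X).toRightDerivedZero' F ≫ (mapInjRes F X).homologyπ 0 :=
  toRightDerivedZero_comp_derivedIso F X

lemma fundB_succ_comp_derivedIso (X : A) (i : ℕ) :
    ((fundamentalSequence F).b (i + 1)).app X ≫ (derivedIso F X (i + 1)).hom =
      satelliteToHomology F X i :=
  (Category.assoc _ _ _).trans ((congrArg _ (Iso.inv_hom_id _)).trans (Category.comp_id _))

lemma fundamentalSequence_isComplex : (fundamentalSequence F).IsComplex := by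
  -- Exactness at `Q` and `P` contains two of the three vanishing conditions. The one at `R` is
  -- checked separately, as exactness there is not available for general `F`.
  refine ⟨fun i => (fundamentalSequence_isExactAtQ F i).1, ?_,
    fun i => ((fundamentalSequence_isExactAtP F).2 i).1⟩
  rintro (_ | i)
  · ext X : 2
    exact (Category.assoc _ _ _).symm.trans ((congrArg (· ≫ _)
      (fundB_zero_comp_derivedIso F X)).trans (toRightDerivedZero_comp F X))
  · ext X : 2
    exact (Category.assoc _ _ _).symm.trans ((congrArg (· ≫ _)
      (fundB_succ_comp_derivedIso F X i)).trans (satelliteToHomology_comp F X i))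

variable {F}

lemma fundamentalSequence_isExactAtR (hF : IsHalfExact F) :
    (fundamentalSequence F).IsExactAtR := by
  rintro (_ | i)
  · refine isExactAt_of_app fun X => (toRightDerivedZero_exact hF X).of_iso (Iso.refl _)
      (derivedIso F X 0).symm (Iso.refl _) ?_ ?_
    · rw [← fundB_zero_comp_derivedIso]
      exact (Category.assoc _ _ _).trans ((congrArg _ (Iso.hom_inv_id _)).trans
        ((Category.comp_id _).trans (Category.id_comp _).symm))
    · exact (Category.comp_id _).trans (Iso.inv_hom_id_assoc _ _).symm
  · refine isExactAt_of_app fun X => (satelliteToHomology_exact hF X i).of_iso (Iso.refl _)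
      (derivedIso F X (i + 1)).symm (Iso.refl _) ?_ ?_
    · exact (Category.id_comp _).symm
    · exact (Category.comp_id _).trans (Iso.inv_hom_id_assoc _ _).symm

end Fundamental

/-! ### Right-derived functors of `(X, -)` -/

section Derived

variable {A : Type u} [Category.{v} A] [Abelian A] [EnoughInjectives A]
  {D : Type*} [Category* D] [Abelian D]

/-- On an injective resolution `α` is an isomorphism in each degree, hence on homology. -/
lemma isIso_rightDerived {F G : A ⥤ D} [F.Additive] [G.Additive] (α : F ⟶ G)
    (hα : ∀ J : A, Injective J → IsIso (α.app J)) (i : ℕ) :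
    IsIso (NatTrans.rightDerived α i) := by
  rw [NatTrans.isIso_iff_isIso_app]
  intro X
  rw [(injectiveResolution X).rightDerived_app_eq]
  have : ∀ j, IsIso (((NatTrans.mapHomologicalComplex α (ComplexShape.up ℕ)).app
      (injectiveResolution X).cocomplex).f j) := fun j =>
    hα _ ((injectiveResolution X).injective j)
  have : IsIso ((NatTrans.mapHomologicalComplex α (ComplexShape.up ℕ)).app
      (injectiveResolution X).cocomplex) :=
    HomologicalComplex.Hom.isIso_of_components _
  infer_instance

/-- Naturality of `ρ` in the functor. After embedding cycles in degree zero, it becomes naturality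
of `α` at the augmentation `X ⟶ I⁰`. -/
lemma toRightDerivedZero_comp_rightDerived {F G : A ⥤ D} [F.Additive] [G.Additive] (α : F ⟶ G) :
    F.toRightDerivedZero ≫ NatTrans.rightDerived α 0 = α ≫ G.toRightDerivedZero := by
  ext X : 2
  rw [NatTrans.comp_app, NatTrans.comp_app, ← cancel_mono (derivedIso G X 0).hom,
    Category.assoc, Category.assoc, toRightDerivedZero_comp_derivedIso]
  have h : (NatTrans.rightDerived α 0).app X ≫ (derivedIso G X 0).hom =
      (derivedIso F X 0).hom ≫ HomologicalComplex.homologyMap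
        ((NatTrans.mapHomologicalComplex α (ComplexShape.up ℕ)).app (injRes X)) 0 := by
    rw [(injectiveResolution X).rightDerived_app_eq, ← Iso.eq_comp_inv]
    exact (Category.assoc _ _ _).symm
  rw [h, ← Category.assoc, toRightDerivedZero_comp_derivedIso, Category.assoc,
    HomologicalComplex.homologyπ_naturality, ← Category.assoc, ← Category.assoc]
  congr 1
  rw [← cancel_mono (cyclesι G X 0), Category.assoc, Category.assoc,
    toRightDerivedZero'_comp_cyclesι, ← α.naturality, ← toRightDerivedZero'_comp_cyclesι,
    Category.assoc]
  congr 1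
  exact HomologicalComplex.cyclesMap_i _ _

/-- The cocycle `X ⟶ Iⁱ` underlying a cycle of the complex `(X, I)`, where `I` is the chosen
injective resolution of `Y`. -/
def cyclesHom (X Y : A) (i : ℕ) (z : (mapInjRes (rep X) Y).cycles i) : X ⟶ (injRes Y).X i :=
  cyclesι (rep X) Y i z

lemma cyclesHom_d (X Y : A) (i : ℕ) (z : (mapInjRes (rep X) Y).cycles i) :
    cyclesHom X Y i z ≫ (injRes Y).d i (i + 1) = 0 :=
  ConcreteCategory.congr_hom (cyclesι_d (rep X) Y i (i + 1)) z

lemma cyclesHom_add (X Y : A) (i : ℕ) (a b : (mapInjRes (rep X) Y).cycles i) :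
    cyclesHom X Y i (a + b) = cyclesHom X Y i a + cyclesHom X Y i b :=
  (cyclesι (rep X) Y i).hom.map_add a b

lemma extMk_congr [HasExt.{v} A] {X Y : A} (R : InjectiveResolution Y) {i : ℕ}
    {f g : X ⟶ R.cocomplex.X i} (h : f = g) (hf : f ≫ R.cocomplex.d i (i + 1) = 0) :
    R.extMk f (i + 1) rfl hf = R.extMk g (i + 1) rfl (h ▸ hf) := by
  subst h
  rfl

/-- The class in `Extⁱ(X, Y)` of a cocycle of the complex `(X, I)`, where `I` is the chosen
injective resolution of `Y`. -/
def cyclesToExt (X Y : A) (i : ℕ) :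
    (mapInjRes (rep X) Y).cycles i ⟶ (extFunctor X i).obj Y :=
  letI : HasExt.{v} A := hasExt_of_enoughInjectives.{v} A
  AddCommGrpCat.ofHom (AddMonoidHom.mk' (fun z =>
    (injectiveResolution Y).extMk (cyclesHom X Y i z) (i + 1) rfl (cyclesHom_d X Y i z))
      (fun a b => (extMk_congr _ (cyclesHom_add X Y i a b) (cyclesHom_d X Y i (a + b))).trans
        (InjectiveResolution.add_extMk _ _ _ _ _ _ _).symm))

lemma toCycles_comp_cyclesToExt (X Y : A) (i : ℕ) :
    (mapInjRes (rep X) Y).toCycles i (i + 1) ≫ cyclesToExt X Y (i + 1) = 0 := by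
  let : HasExt.{v} A := hasExt_of_enoughInjectives.{v} A
  ext f
  exact ((injectiveResolution Y).extMk_eq_zero_iff _ (i + 1 + 1) rfl
    (cyclesHom_d X Y (i + 1) _) i rfl).2
    ⟨f, (ConcreteCategory.congr_hom (dToCycles_ι (rep X) Y i (i + 1)) f).symm⟩

/-- The map `Hⁱ⁺¹((X, I)) ⟶ Extⁱ⁺¹(X, Y)`, where `I` is the chosen injective resolution
of `Y`. -/
def homologyToExt (X Y : A) (i : ℕ) :
    (mapInjRes (rep X) Y).homology (i + 1) ⟶ (extFunctor X (i + 1)).obj Y :=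
  ((mapInjRes (rep X) Y).homologyIsCokernel i (i + 1) (by simp)).desc
    (CokernelCofork.ofπ (cyclesToExt X Y (i + 1)) (toCycles_comp_cyclesToExt X Y i))

lemma homologyπ_homologyToExt (X Y : A) (i : ℕ) :
    (mapInjRes (rep X) Y).homologyπ (i + 1) ≫ homologyToExt X Y i = cyclesToExt X Y (i + 1) :=
  ((mapInjRes (rep X) Y).homologyIsCokernel i (i + 1) (by simp)).fac _ WalkingParallelPair.one

/-- Every class in `Extⁱ⁺¹` comes from a cocycle `X ⟶ Iⁱ⁺¹`, and it is zero exactly when the cocycle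
factors through the differential from `Iⁱ`. -/
instance (X Y : A) (i : ℕ) : IsIso (homologyToExt X Y i) := by
  let : HasExt.{v} A := hasExt_of_enoughInjectives.{v} A
  rw [ConcreteCategory.isIso_iff_bijective]
  constructor
  · refine (injective_iff_map_eq_zero (homologyToExt X Y i).hom).2 fun x hx => ?_
    obtain ⟨z, rfl⟩ := (AddCommGrpCat.epi_iff_surjective
      ((mapInjRes (rep X) Y).homologyπ (i + 1))).1 inferInstance x
    have hz : cyclesToExt X Y (i + 1) z = 0 :=
      (ConcreteCategory.congr_hom (homologyπ_homologyToExt X Y i) z).symm.trans hx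
    obtain ⟨f, hf⟩ := ((injectiveResolution Y).extMk_eq_zero_iff _ (i + 1 + 1) rfl
      (cyclesHom_d X Y (i + 1) z) i rfl).1 hz
    have hf' : dToCycles (rep X) Y i (i + 1) f = z := by
      apply (AddCommGrpCat.mono_iff_injective (cyclesι (rep X) Y (i + 1))).1 inferInstance
      exact (ConcreteCategory.congr_hom (dToCycles_ι (rep X) Y i (i + 1)) f).trans hf
    rw [← hf']
    exact ConcreteCategory.congr_hom (dToCycles_comp_homologyπ (rep X) Y i (i + 1)) f
  · intro α
    obtain ⟨f, hf, rfl⟩ := (injectiveResolution Y).extMk_surjective α (i + 1 + 1) rfl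
    obtain ⟨z, hz⟩ := (ShortComplex.ab_exact_iff _).1
      (ShortComplex.exact_of_f_is_kernel (ShortComplex.mk _ _
        ((mapInjRes (rep X) Y).iCycles_d (i + 1) (i + 1 + 1)))
          ((mapInjRes (rep X) Y).cyclesIsKernel (i + 1) (i + 1 + 1) (by simp))) f hf
    refine ⟨(mapInjRes (rep X) Y).homologyπ (i + 1) z,
      (ConcreteCategory.congr_hom (homologyπ_homologyToExt X Y i) z).trans ?_⟩
    exact extMk_congr _ hz (cyclesHom_d X Y (i + 1) z)

lemma homologyToExt_naturality (X : A) {Y Y' : A} (f : Y ⟶ Y') (i : ℕ) :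
    HomologicalComplex.homologyMap (mapInjResMap (rep X) f) (i + 1) ≫ homologyToExt X Y' i =
      homologyToExt X Y i ≫ (extFunctor X (i + 1)).map f := by
  let : HasExt.{v} A := hasExt_of_enoughInjectives.{v} A
  rw [← cancel_epi ((mapInjRes (rep X) Y).homologyπ (i + 1)),
    HomologicalComplex.homologyπ_naturality_assoc, homologyπ_homologyToExt,
    reassoc_of% homologyπ_homologyToExt X Y i]
  ext z
  -- The chosen lift of `f` is compatible with the augmentations, so pushing a cocycle along it
  -- represents the product of its class with `f`.
  let φ : InjectiveResolution.Hom (injectiveResolution Y) (injectiveResolution Y') f :=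
    { hom := injResMap f
      ι_f_zero_comp_hom_f_zero :=
        HomologicalComplex.congr_hom (InjectiveResolution.desc_commutes f _ _) 0 }
  exact (extMk_congr _ (ConcreteCategory.congr_hom (cyclesι_naturality (rep X) f (i + 1)) z)
    (cyclesHom_d X Y' (i + 1) _)).trans (InjectiveResolution.extMk_comp_mk₀ _ (i + 1 + 1) rfl
      (cyclesHom_d X Y (i + 1) z) φ).symm

/-- The right-derived functors of `(X, -)` are the functors `Extⁱ(X, -)`. -/
def rightDerivedRepIso (X : A) (i : ℕ) :
    (rep X).rightDerived (i + 1) ≅ extFunctor X (i + 1) :=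
  NatIso.ofComponents (fun Y => derivedIso (rep X) Y (i + 1) ≪≫ asIso (homologyToExt X Y i))
    (fun {Y Y'} f => by
      simp only [Iso.trans_hom, asIso_hom, Category.assoc]
      rw [← homologyToExt_naturality, ← Category.assoc, derivedIso_hom_naturality,
        Category.assoc])

end Derived

/-! ### Exactness properties of representable functors -/

section Representable

variable {A : Type u} [Category.{v} A] [Abelian A]

lemma mono_repMap {X Y : A} (f : X ⟶ Y) [Epi f] : Mono (repMap f) := by
  rw [NatTrans.mono_iff_mono_app]
  intro M
  rw [AddCommGrpCat.mono_iff_injective]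
  exact fun a b h => (cancel_epi f).1 h

lemma repMap_isExactAt {X Y Z : A} {f : X ⟶ Y} {g : Y ⟶ Z} (h : IsExactAt f g) [Epi g] :
    IsExactAt (repMap g) (repMap f) := by
  obtain ⟨w, h⟩ := h
  refine isExactAt_of_app fun M => ⟨?_, (ShortComplex.ab_exact_iff _).2 fun φ hφ =>
    ⟨h.desc φ hφ, h.g_desc φ hφ⟩⟩
  ext φ
  exact (Category.assoc _ _ _).symm.trans ((congrArg (· ≫ (φ : Z ⟶ M)) w).trans zero_comp)

/-- Epimorphisms of additive functors are objectwise epimorphisms. -/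
lemma epi_app_of_epi {D : Type*} [Category* D] [Abelian D] {G H : A ⥤+ D} (g : G ⟶ H) [Epi g]
    (X : A) : Epi (g.hom.app X) := by
  -- The cokernel formed among all functors is a quotient of `H`, hence additive. Its projection can
  -- thus be tested against `g` inside additive functors, where it must be zero.
  have hc : (cokernel g.hom).Additive :=
    additive_of_mono_of_epi (𝟙 H.obj) (cokernel.π g.hom) H.property
  let p : H ⟶ AdditiveFunctor.of (cokernel g.hom) := ObjectProperty.homMk (cokernel.π g.hom)
  have hp : p = ObjectProperty.homMk 0 := by
    rw [← cancel_epi g]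
    ext1
    exact (cokernel.condition g.hom).trans comp_zero.symm
  have : Epi g.hom := Preadditive.epi_of_cokernel_zero (congrArg (·.hom) hp)
  infer_instance

/-- Yoneda: a map out of `(X, -)` is fixed by the image of `𝟙 X`, and that element lifts because
epimorphisms are objectwise surjective. -/
lemma projective_rep (X : A) : Projective (AdditiveFunctor.of (rep X)) where
  factors {E H} f g _ := by
    have := epi_app_of_epi g X
    obtain ⟨x, hx⟩ := (AddCommGrpCat.epi_iff_surjective (g.hom.app X)).1 this
      (f.hom.app X (𝟙 X))
    refine ⟨ObjectProperty.homMk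
      { app M := AddCommGrpCat.ofHom (AddMonoidHom.mk' (fun φ => E.obj.map φ x)
          fun φ ψ => ?_)
        naturality {M N} t := ?_ }, ?_⟩
    · exact ConcreteCategory.congr_hom
        (E.obj.map_add (f := (φ : X ⟶ M)) (g := (ψ : X ⟶ M))) x
    · ext φ
      exact ConcreteCategory.congr_hom (E.obj.map_comp φ t) x
    · ext M φ
      refine (ConcreteCategory.congr_hom (g.hom.naturality φ) x).trans ?_
      refine (congrArg (H.obj.map φ) hx).trans ?_
      refine (ConcreteCategory.congr_hom (f.hom.naturality φ) (𝟙 X)).symm.trans ?_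
      exact congrArg (f.hom.app M) (Category.id_comp φ)

end Representable

/-! ### Cocycles and cohomology classes -/

section Cohomology

variable {A : Type u} [Category.{v} A] [Abelian A] (C : ChainComplex A ℤ) (n : ℤ)

/-- The morphism `Cₙ ⟶ M` underlying a cocycle. -/
def cocycleHom {M : A} (z : ((homComplex C).cycles n).obj M) : C.X n ⟶ M :=
  (cocyclesι C n).app M z

instance : Mono (cocyclesι C n) := inferInstanceAs (Mono ((homComplex C).iCycles n))

instance : Epi (cocyclesπ C n) := inferInstanceAs (Epi ((homComplex C).homologyπ n))

variable {C n} in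
lemma cocycleHom_injective {M : A} {z z' : ((homComplex C).cycles n).obj M}
    (h : cocycleHom C n z = cocycleHom C n z') : z = z' :=
  (AddCommGrpCat.mono_iff_injective ((cocyclesι C n).app M)).1 inferInstance h

lemma cocyclesι_isExactAt : IsExactAt (cocyclesι C n) (repMap (C.d (n + 1) n)) :=
  ⟨(homComplex C).iCycles_d n (n + 1), ShortComplex.exact_of_f_is_kernel _
    ((homComplex C).cyclesIsKernel n (n + 1) (ComplexShape.next_eq' _ (by simp)))⟩

lemma toCocycles_isExactAt : IsExactAt ((homComplex C).toCycles (n - 1) n) (cocyclesπ C n) :=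
  ⟨(homComplex C).toCycles_comp_homologyπ (n - 1) n, ShortComplex.exact_of_g_is_cokernel _
    ((homComplex C).homologyIsCokernel (n - 1) n (ComplexShape.prev_eq' _ (by simp)))⟩

lemma IsExactAt.exists_of_app_eq_zero {B : Type*} [Category* B] {F G H : B ⥤ AddCommGrpCat.{v}}
    {f : F ⟶ G} {g : G ⟶ H} (h : IsExactAt f g) {M : B} (y : G.obj M) (hy : g.app M y = 0) :
    ∃ x, f.app M x = y :=
  (ShortComplex.ab_exact_iff _).1 (h.2.map ((evaluation _ _).obj M)) y hy

lemma d_cocycleHom {M : A} (z : ((homComplex C).cycles n).obj M) :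
    C.d (n + 1) n ≫ cocycleHom C n z = 0 :=
  ConcreteCategory.congr_hom (NatTrans.congr_app (cocyclesι_isExactAt C n).1 M) z

lemma exists_cocycleHom {M : A} (φ : C.X n ⟶ M) (h : C.d (n + 1) n ≫ φ = 0) :
    ∃ z, cocycleHom C n z = φ :=
  (cocyclesι_isExactAt C n).exists_of_app_eq_zero φ h

lemma cocyclesπ_surjective {M : A} (x : (cohomologyFunctor C n).obj M) :
    ∃ z, (cocyclesπ C n).app M z = x :=
  (AddCommGrpCat.epi_iff_surjective ((cocyclesπ C n).app M)).1 inferInstance x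

lemma cocycleHom_toCycles {M : A} (θ : C.X (n - 1) ⟶ M) :
    cocycleHom C n (((homComplex C).toCycles (n - 1) n).app M θ) = C.d n (n - 1) ≫ θ :=
  ConcreteCategory.congr_hom (NatTrans.congr_app ((homComplex C).toCycles_i (n - 1) n) M) θ

lemma cocyclesπ_eq_zero_iff {M : A} (z : ((homComplex C).cycles n).obj M) :
    (cocyclesπ C n).app M z = 0 ↔
      ∃ θ : C.X (n - 1) ⟶ M, C.d n (n - 1) ≫ θ = cocycleHom C n z := by
  constructor
  · intro h
    obtain ⟨θ, rfl⟩ := (toCocycles_isExactAt C n).exists_of_app_eq_zero z h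
    exact ⟨θ, (cocycleHom_toCycles C n θ).symm⟩
  · rintro ⟨θ, hθ⟩
    obtain rfl := cocycleHom_injective ((cocycleHom_toCycles C n θ).trans hθ)
    exact ConcreteCategory.congr_hom (NatTrans.congr_app (toCocycles_isExactAt C n).1 M) θ

lemma cocycleHom_map {M N : A} (z : ((homComplex C).cycles n).obj M) (f : M ⟶ N) :
    cocycleHom C n (((homComplex C).cycles n).map f z) = cocycleHom C n z ≫ f :=
  ConcreteCategory.congr_hom ((cocyclesι C n).naturality f) z

lemma cocyclesπ_map {M N : A} (z : ((homComplex C).cycles n).obj M) (f : M ⟶ N) :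
    (cocyclesπ C n).app N (((homComplex C).cycles n).map f z) =
      (cohomologyFunctor C n).map f ((cocyclesπ C n).app M z) :=
  ConcreteCategory.congr_hom ((cocyclesπ C n).naturality f) z

lemma cocycleHom_sub {M : A} (z z' : ((homComplex C).cycles n).obj M) :
    cocycleHom C n (z - z') = cocycleHom C n z - cocycleHom C n z' :=
  ((cocyclesι C n).app M).hom.map_sub z z'

/-- Projectivity in degree `n - 1` suffices: it lifts the cochain `θ` whose coboundary is the image
of the cocycle in `S.X₃`. -/
lemma cohomologyFunctor_isHalfExact (hC : Projective (C.X (n - 1))) :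
    IsHalfExact (cohomologyFunctor C n) := by
  intro S hS
  have := hS.mono_f
  have := hS.epi_g
  refine (ShortComplex.ab_exact_iff _).2 fun (y : (cohomologyFunctor C n).obj S.X₂) hy => ?_
  obtain ⟨z, rfl⟩ := cocyclesπ_surjective C n y
  obtain ⟨θ, hθ⟩ := (cocyclesπ_eq_zero_iff C n _).1 ((cocyclesπ_map C n z S.g).trans hy)
  rw [cocycleHom_map] at hθ
  obtain ⟨b, hb⟩ : ∃ b, (cocyclesπ C n).app S.X₂ b = 0 ∧
      cocycleHom C n b = C.d n (n - 1) ≫ Projective.factorThru θ S.g :=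
    ⟨_, (cocyclesπ_eq_zero_iff C n _).2 ⟨_, (cocycleHom_toCycles C n _).symm⟩,
      cocycleHom_toCycles C n _⟩
  -- Subtracting the coboundary `b` of the lifted cochain makes the image in `S.X₃` zero on the
  -- nose, so the cocycle factors through `S.X₁`.
  have h : cocycleHom C n (z - b) ≫ S.g = 0 := by
    rw [cocycleHom_sub, hb.2, Preadditive.sub_comp, Category.assoc,
      Projective.factorThru_comp, hθ, sub_self]
  obtain ⟨x, hx⟩ := exists_cocycleHom C n (hS.exact.lift _ h) (by
    rw [← cancel_mono S.f, Category.assoc, hS.exact.lift_f, d_cocycleHom, zero_comp])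
  refine ⟨(cocyclesπ C n).app S.X₁ x, (cocyclesπ_map C n x S.f).symm.trans ?_⟩
  have h' : ((homComplex C).cycles n).map S.f x = z - b :=
    cocycleHom_injective ((cocycleHom_map C n x S.f).trans (by rw [hx, hS.exact.lift_f]))
  rw [h', map_sub, hb.1, sub_zero]

/-! ### The evaluation map -/

lemma toPrevBoundaries_comp {M : A} (θ : C.X (n - 1) ⟶ M) :
    toPrevBoundaries C n ≫ prevBoundariesι C n ≫ θ = C.d n (n - 1) ≫ θ :=
  image.fac_assoc _ _

lemma iCycles_toPrevBoundaries_isExactAt : IsExactAt (C.iCycles n) (toPrevBoundaries C n) := by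
  have w : C.iCycles n ≫ toPrevBoundaries C n = 0 := by
    rw [← cancel_mono (prevBoundariesι C n), Category.assoc, image.fac, C.iCycles_d, zero_comp]
  refine ⟨w, ShortComplex.exact_of_f_is_kernel _ (KernelFork.IsLimit.ofι' _ _ fun {W} k hk =>
    ⟨C.liftCycles k (n - 1) (ComplexShape.next_eq' _ (by simp)) ?_,
      HomologicalComplex.liftCycles_i _ _ _ _ _⟩)⟩
  rw [← image.fac (C.d n (n - 1)), ← Category.assoc, hk, zero_comp]

lemma toCycles_homologyπ_isExactAt : IsExactAt (C.toCycles (n + 1) n) (C.homologyπ n) :=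
  ⟨C.toCycles_comp_homologyπ _ _, ShortComplex.exact_of_g_is_cokernel _
    (C.homologyIsCokernel (n + 1) n (ComplexShape.prev_eq' _ (by simp)))⟩

/-- The map sending a cocycle to the morphism that it induces on homology. -/
def cocyclesEval : (homComplex C).cycles n ⟶ rep (C.homology n) :=
  have := mono_repMap (C.homologyπ n)
  (repMap_isExactAt (toCycles_homologyπ_isExactAt C n)).2.lift
    (cocyclesι C n ≫ repMap (C.iCycles n)) (by
      rw [Category.assoc, ← Functor.map_comp, ← op_comp, HomologicalComplex.toCycles_i]
      exact (cocyclesι_isExactAt C n).1)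

lemma cocyclesEval_comp :
    cocyclesEval C n ≫ repMap (C.homologyπ n) = cocyclesι C n ≫ repMap (C.iCycles n) :=
  have := mono_repMap (C.homologyπ n)
  (repMap_isExactAt (toCycles_homologyπ_isExactAt C n)).2.lift_f _ _

lemma homologyπ_comp_cocyclesEval {M : A} (z : ((homComplex C).cycles n).obj M) :
    C.homologyπ n ≫ ((cocyclesEval C n).app M z : C.homology n ⟶ M) =
      C.iCycles n ≫ cocycleHom C n z :=
  ConcreteCategory.congr_hom (NatTrans.congr_app (cocyclesEval_comp C n) M) z

lemma toCycles_comp_cocyclesEval :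
    (homComplex C).toCycles (n - 1) n ≫ cocyclesEval C n = 0 := by
  ext M θ
  refine (cancel_epi (C.homologyπ n)).1 ?_
  refine (homologyπ_comp_cocyclesEval C n _).trans
    ((congrArg (C.iCycles n ≫ ·) (cocycleHom_toCycles C n θ)).trans
      ((Category.assoc _ _ _).symm.trans (Eq.trans ?_ comp_zero.symm)))
  exact (congrArg (· ≫ (θ : C.X (n - 1) ⟶ M)) (C.iCycles_d n (n - 1))).trans zero_comp

/-- The canonical evaluation map `Hⁿ(C, -) ⟶ (H_n(C), -)`. -/
def evaluationMap : cohomologyFunctor C n ⟶ rep (C.homology n) :=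
  (toCocycles_isExactAt C n).2.desc (cocyclesEval C n) (toCycles_comp_cocyclesEval C n)

lemma cocyclesπ_evaluationMap : cocyclesπ C n ≫ evaluationMap C n = cocyclesEval C n :=
  (toCocycles_isExactAt C n).2.g_desc _ _

lemma isEvaluation_evaluationMap : IsEvaluation C n (evaluationMap C n) := by
  rw [IsEvaluation, ← Category.assoc, cocyclesπ_evaluationMap, cocyclesEval_comp]

lemma homologyπ_comp_evaluationMap {M : A} (z : ((homComplex C).cycles n).obj M) :
    C.homologyπ n ≫ ((evaluationMap C n).app M ((cocyclesπ C n).app M z) : C.homology n ⟶ M) =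
      C.iCycles n ≫ cocycleHom C n z :=
  (congrArg (C.homologyπ n ≫ ·) (ConcreteCategory.congr_hom
    (NatTrans.congr_app (cocyclesπ_evaluationMap C n) M) z)).trans
      (homologyπ_comp_cocyclesEval C n z)

/-- A cohomology class in the kernel of the evaluation map is represented by a cocycle which
factors through the boundaries. -/
lemma exists_factor_of_evaluationMap_eq_zero {M : A} (z : ((homComplex C).cycles n).obj M)
    (h : (evaluationMap C n).app M ((cocyclesπ C n).app M z) = 0) :
    ∃ ψ : prevBoundaries C n ⟶ M, toPrevBoundaries C n ≫ ψ = cocycleHom C n z := by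
  -- The cocycle vanishes on `Z_n`, and `C_n ⟶ B_{n-1}` is the cokernel of `Z_n ⟶ C_n`.
  have h' : C.iCycles n ≫ cocycleHom C n z = 0 := by
    rw [← homologyπ_comp_evaluationMap]
    exact (congrArg (C.homologyπ n ≫ ·) h).trans comp_zero
  have : Epi (ShortComplex.mk _ _ (iCycles_toPrevBoundaries_isExactAt C n).1).g :=
    inferInstanceAs (Epi (toPrevBoundaries C n))
  exact ⟨(iCycles_toPrevBoundaries_isExactAt C n).2.desc _ h',
    (iCycles_toPrevBoundaries_isExactAt C n).2.g_desc _ h'⟩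

/-- Both halves are extension problems into `J`. For injectivity, `B_{n-1} ⟶ J` extends to
`C_{n-1}`, exhibiting a coboundary; for surjectivity, `Z_n ⟶ H_n(C) ⟶ J` extends to `C_n`, and the
extension is a cocycle because it kills boundaries. -/
lemma isIso_evaluationMap_app (J : A) [Injective J] : IsIso ((evaluationMap C n).app J) := by
  rw [ConcreteCategory.isIso_iff_bijective]
  constructor
  · refine (injective_iff_map_eq_zero ((evaluationMap C n).app J).hom).2 fun x hx => ?_
    obtain ⟨z, rfl⟩ := cocyclesπ_surjective C n x
    obtain ⟨ψ, hψ⟩ := exists_factor_of_evaluationMap_eq_zero C n z hx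
    refine (cocyclesπ_eq_zero_iff C n z).2 ⟨Injective.factorThru ψ (prevBoundariesι C n), ?_⟩
    rw [← hψ, ← toPrevBoundaries_comp, Injective.comp_factorThru]
  · intro f
    change C.homology n ⟶ J at f
    obtain ⟨z, hz⟩ := exists_cocycleHom C n
      (Injective.factorThru (C.homologyπ n ≫ f) (C.iCycles n)) (by
        rw [← C.toCycles_i (n + 1) n, Category.assoc, Injective.comp_factorThru,
          ← Category.assoc, C.toCycles_comp_homologyπ, zero_comp])
    refine ⟨(cocyclesπ C n).app J z, (cancel_epi (C.homologyπ n)).1 ?_⟩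
    exact (homologyπ_comp_evaluationMap C n z).trans
      (by rw [hz, Injective.comp_factorThru])

variable [EnoughInjectives A]

/-- The right-derived functors of `Hⁿ(C, -)` are those of `(H_n(C), -)`. -/
def rightDerivedCohomologyIso (i : ℕ) :
    (cohomologyFunctor C n).rightDerived i ≅ (rep (C.homology n)).rightDerived i :=
  have := isIso_rightDerived (evaluationMap C n) (fun J _ => isIso_evaluationMap_app C n J) i
  asIso (NatTrans.rightDerived (evaluationMap C n) i)

/-- The zeroth right-derived functor of `Hⁿ(C, -)` is `(H_n(C), -)`. -/
def rightDerivedZeroCohomologyIso :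
    (cohomologyFunctor C n).rightDerived 0 ≅ rep (C.homology n) :=
  rightDerivedCohomologyIso C n 0 ≪≫ (rep (C.homology n)).rightDerivedZeroIsoSelf

/-- Naturality of `ρ` along the evaluation map, combined with `ρ` being invertible on the left exact
functor `(H_n(C), -)`. -/
lemma toRightDerivedZero_comp_rightDerivedZeroCohomologyIso :
    (cohomologyFunctor C n).toRightDerivedZero ≫ (rightDerivedZeroCohomologyIso C n).hom =
      evaluationMap C n := by
  change _ ≫ NatTrans.rightDerived (evaluationMap C n) 0 ≫
    (rep (C.homology n)).rightDerivedZeroIsoSelf.hom = _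
  rw [← Category.assoc, toRightDerivedZero_comp_rightDerived, Category.assoc,
    Functor.rightDerivedZeroIsoSelf_inv_hom_id, Category.comp_id]

/-- The right-derived functors of `Hⁿ(C, -)` are `(H_n(C), -)` and `Extⁱ(H_n(C), -)`. -/
def rightDerivedCohomologyIsoHomExt : ∀ i : ℕ,
    (cohomologyFunctor C n).rightDerived i ≅ homExtFunctor (C.homology n) i
  | 0 => rightDerivedZeroCohomologyIso C n
  | i + 1 => rightDerivedCohomologyIso C n (i + 1) ≪≫ rightDerivedRepIso (C.homology n) i

lemma subStabι_comp_evaluationMap :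
    subStabι (cohomologyFunctor C n) ≫ evaluationMap C n = 0 := by
  rw [← toRightDerivedZero_comp_rightDerivedZeroCohomologyIso, ← Category.assoc]
  exact (congrArg (· ≫ _) (kernel.condition _)).trans zero_comp

/-! ### The sub-stabilization of cohomology -/

/-- The map sending `ψ : B_{n-1} ⟶ M` to the cocycle `Cₙ ⟶ B_{n-1} ⟶ M`. -/
def boundariesToCocycles : rep (prevBoundaries C n) ⟶ (homComplex C).cycles n :=
  have : Mono (ShortComplex.mk _ _ (cocyclesι_isExactAt C n).1).f :=
    inferInstanceAs (Mono (cocyclesι C n))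
  (cocyclesι_isExactAt C n).2.lift (repMap (toPrevBoundaries C n)) (by
    change repMap (toPrevBoundaries C n) ≫ repMap (C.d (n + 1) n) = 0
    have : C.d (n + 1) n ≫ toPrevBoundaries C n = 0 := by
      rw [← cancel_mono (prevBoundariesι C n), Category.assoc, image.fac, C.d_comp_d, zero_comp]
    rw [← Functor.map_comp, ← op_comp, this, op_zero, Functor.map_zero])

lemma boundariesToCocycles_ι :
    boundariesToCocycles C n ≫ cocyclesι C n = repMap (toPrevBoundaries C n) :=
  have : Mono (ShortComplex.mk _ _ (cocyclesι_isExactAt C n).1).f :=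
    inferInstanceAs (Mono (cocyclesι C n))
  (cocyclesι_isExactAt C n).2.lift_f _ _

lemma cocycleHom_boundariesToCocycles {M : A} (ψ : prevBoundaries C n ⟶ M) :
    cocycleHom C n ((boundariesToCocycles C n).app M ψ) = toPrevBoundaries C n ≫ ψ :=
  ConcreteCategory.congr_hom (NatTrans.congr_app (boundariesToCocycles_ι C n) M) ψ

lemma boundariesToCocycles_comp_evaluationMap :
    (boundariesToCocycles C n ≫ cocyclesπ C n) ≫ evaluationMap C n = 0 := by
  have := mono_repMap (C.homologyπ n)
  rw [← cancel_mono (repMap (C.homologyπ n)), Category.assoc, Category.assoc,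
    isEvaluation_evaluationMap C n, reassoc_of% boundariesToCocycles_ι C n,
    ← Functor.map_comp, ← op_comp, (iCycles_toPrevBoundaries_isExactAt C n).1, op_zero,
    Functor.map_zero, zero_comp]

/-- The canonical map `(B_{n-1}, -) ⟶ subStab Hⁿ(C, -)`. -/
def classMap : rep (prevBoundaries C n) ⟶ subStab (cohomologyFunctor C n) :=
  kernel.lift _ (boundariesToCocycles C n ≫ cocyclesπ C n) (by
    -- Under this isomorphism `ρ` becomes evaluation, which kills cocycles factoring through
    -- `B_{n-1}`.
    rw [← cancel_mono (rightDerivedZeroCohomologyIso C n).hom, Category.assoc,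
      toRightDerivedZero_comp_rightDerivedZeroCohomologyIso,
      boundariesToCocycles_comp_evaluationMap, zero_comp])

lemma classMap_ι :
    classMap C n ≫ subStabι (cohomologyFunctor C n) =
      boundariesToCocycles C n ≫ cocyclesπ C n :=
  kernel.lift_ι _ _ _

lemma classMap_ι_app {M : A} (ψ : prevBoundaries C n ⟶ M) :
    (subStabι (cohomologyFunctor C n)).app M ((classMap C n).app M ψ) =
      (cocyclesπ C n).app M ((boundariesToCocycles C n).app M ψ) :=
  ConcreteCategory.congr_hom (NatTrans.congr_app (classMap_ι C n) M) ψ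

lemma isClassMap_classMap : IsClassMap C n (classMap C n) := by
  rw [IsClassMap, ← Category.assoc, classMap_ι, ← boundariesToCocycles_ι, Category.assoc,
    Category.assoc]
  congr 1
  exact (homComplex C).homology_π_ι n

lemma subStabι_app_injective {M : A} {x y : (subStab (cohomologyFunctor C n)).obj M}
    (h : (subStabι (cohomologyFunctor C n)).app M x =
      (subStabι (cohomologyFunctor C n)).app M y) : x = y :=
  (AddCommGrpCat.mono_iff_injective ((subStabι (cohomologyFunctor C n)).app M)).1 inferInstance h

lemma epi_classMap : Epi (classMap C n) := by
  rw [NatTrans.epi_iff_epi_app]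
  intro M
  rw [AddCommGrpCat.epi_iff_surjective]
  intro x
  obtain ⟨z, hz⟩ := cocyclesπ_surjective C n ((subStabι (cohomologyFunctor C n)).app M x)
  obtain ⟨ψ, hψ⟩ := exists_factor_of_evaluationMap_eq_zero C n z (by
    rw [hz]
    exact ConcreteCategory.congr_hom (NatTrans.congr_app (subStabι_comp_evaluationMap C n) M) x)
  refine ⟨ψ, subStabι_app_injective C n ((classMap_ι_app C n ψ).trans ?_)⟩
  rw [cocycleHom_injective ((cocycleHom_boundariesToCocycles C n ψ).trans hψ), hz]

/-- Since `C_n ⟶ B_{n-1}` is an epimorphism, the cocycle of `ψ` is the coboundary of `θ` exactly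
when `θ` restricts to `ψ` on `B_{n-1}`. -/
lemma classMap_isExactAt : IsExactAt (repMap (prevBoundariesι C n)) (classMap C n) := by
  refine isExactAt_of_app fun M => ⟨?_, (ShortComplex.ab_exact_iff _).2
    fun (ψ : prevBoundaries C n ⟶ M) hψ => ?_⟩
  · ext θ
    refine subStabι_app_injective C n ((classMap_ι_app C n _).trans (Eq.trans ?_
      (map_zero ((subStabι (cohomologyFunctor C n)).app M).hom).symm))
    refine (cocyclesπ_eq_zero_iff C n _).2 ⟨θ, ?_⟩
    exact ((cocycleHom_boundariesToCocycles C n _).trans (toPrevBoundaries_comp C n θ)).symm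
  · have h := (classMap_ι_app C n ψ).symm.trans ((congrArg _ hψ).trans
      (map_zero ((subStabι (cohomologyFunctor C n)).app M).hom))
    obtain ⟨θ, hθ⟩ := (cocyclesπ_eq_zero_iff C n _).1 h
    refine ⟨θ, (cancel_epi (toPrevBoundaries C n)).1 ?_⟩
    rw [← cocycleHom_boundariesToCocycles, ← hθ]
    exact toPrevBoundaries_comp C n θ

lemma isProjectiveResolution_classMap :
    IsProjectiveResolution (repMap (prevBoundariesπ C n)) (repMap (prevBoundariesι C n))
      (classMap C n) where
  projective₂ := projective_rep _
  projective₁ := projective_rep _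
  projective₀ := projective_rep _
  mono := mono_repMap _
  exact₁ := repMap_isExactAt
    ⟨cokernel.condition _, ShortComplex.exact_cokernel (prevBoundariesι C n)⟩
  exact₀ := classMap_isExactAt C n
  epi := epi_classMap C n

end Cohomology

end FundSeq

end

theorem mainTheorem5 {A : Type u} [Category.{v} A] [Abelian A] [EnoughInjectives A]
    (C : ChainComplex A ℤ) (n : ℤ) :
    (∃ e : ∀ i : ℕ, (FundSeq.cohomologyFunctor C n).rightDerived i ≅
        FundSeq.homExtFunctor (C.homology n) i,
      FundSeq.IsEvaluation C n
        ((FundSeq.cohomologyFunctor C n).toRightDerivedZero ≫ (e 0).hom) ∧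
      (let S := (FundSeq.fundamentalSequence (FundSeq.cohomologyFunctor C n)).replaceR e
       S.IsComplex ∧ S.IsExactAtP ∧ S.IsExactAtQ ∧
         (FundSeq.IsHalfExact (FundSeq.cohomologyFunctor C n) → S.IsExactAtR))) ∧
    (∃ q : FundSeq.rep (FundSeq.prevBoundaries C n) ⟶
        FundSeq.subStab (FundSeq.cohomologyFunctor C n),
      FundSeq.IsClassMap C n q ∧
      FundSeq.IsProjectiveResolution (FundSeq.repMap (FundSeq.prevBoundariesπ C n))
        (FundSeq.repMap (FundSeq.prevBoundariesι C n)) q) ∧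
    ((∀ i : ℤ, Projective (C.X i)) → FundSeq.IsHalfExact (FundSeq.cohomologyFunctor C n)) := by
  refine ⟨⟨FundSeq.rightDerivedCohomologyIsoHomExt C n, ?_,
      (FundSeq.fundamentalSequence_isComplex _).replaceR _,
      (FundSeq.fundamentalSequence_isExactAtP _).replaceR _,
      (FundSeq.fundamentalSequence_isExactAtQ _).replaceR _,
      fun h => (FundSeq.fundamentalSequence_isExactAtR h).replaceR _⟩,
    ⟨FundSeq.classMap C n, FundSeq.isClassMap_classMap C n,
      FundSeq.isProjectiveResolution_classMap C n⟩,
    fun h => FundSeq.cohomologyFunctor_isHalfExact C n (h (n - 1))⟩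
  exact (congrArg (FundSeq.IsEvaluation C n)
    (FundSeq.toRightDerivedZero_comp_rightDerivedZeroCohomologyIso C n)).mpr
      (FundSeq.isEvaluation_evaluationMap C n)
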